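/- **Theorem 4.1.** Let $d\ge 3$ and $q\ge 1$ be integers. Let $\phi\in C^q([0,\infty))$ be real-valued and non-increasing with $\phi(t)=1$ for $t\in[0,1/2]$ and $\phi(t)=0$ for $t\ge 1$, and let $\kappa(t)=\sqrt{\phi(t/2)^2-\phi(t)^2}$, $t\ge 0$. Assume that $\kappa\in C^q([0,\infty))$ and that there is some $t_0\in(1/2,2)$ such that $\kappa^{(q)}(t)\ne 0$ for each $t\in(1/2,t_0)$. For $n\in\mathbb N_0$ let $\mathcal I_n^d$ be the set of integer tuples $k=(k_1,\dots,k_{d-2})$ with $n\ge k_1\ge\dots\ge k_{d-3}\ge|k_{d-2}|$, put $k_0=n$, and let $Y_k^{d,n}\colon\mathbb S^{d-1}\to\mathbb C$, $k\in\mathcal I_n^d$, be the spherical harmonics $$Y_k^{d,n}=A_k^n\prod_{j=0}^{d-3}C_{k_j-|k_{j+1}|}^{\frac{d-j-2}{2}+|k_{j+1}|}(\cos\theta_{d-j-1})\,\sin^{|k_{j+1}|}(\theta_{d-j-1})\;\mathrm e^{\mathrm ik_{d-2}\theta_1}$$ in the spherical coordinates $\theta_1\in(-\pi,\pi]$, $\theta_2,\dots,\theta_{d-1}\in[0,\pi]$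 given by $x_1=\sin\theta_{d-1}\cdots\sin\theta_2\sin\theta_1$, $x_2=\sin\theta_{d-1}\cdots\sin\theta_2\cos\theta_1$, and $x_m=\sin\theta_{d-1}\cdots\sin\theta_m\cos\theta_{m-1}$ for $3\le m\le d$. Here $C_m^\lambda$ are the Gegenbauer polynomials in the usual normalization ($C_0^\lambda=1$, $C_1^\lambda(t)=2\lambda t$, $mC_m^\lambda(t)=2(m+\lambda-1)tC_{m-1}^\lambda(t)-(m+2\lambda-2)C_{m-2}^\lambda(t)$), and $A_k^n>0$ is given by $$(A_k^n)^2=\frac{2^{(d-4)(d-2)}}{\Gamma(\frac d2)}\prod_{j=0}^{d-3}\frac{2^{2|k_{j+1}|-j}(k_j-|k_{j+1}|)!\,(2k_j+d-j-2)\,\Gamma(\frac{d-j-2}{2}+|k_{j+1}|)^2}{\sqrt\pi\,\Gamma(k_j+|k_{j+1}|+d-j-2)}.$$ Let $\mathcal H_n^d=\operatorname{span}\{Y_k^{d,n}:k\in\mathcal I_n^d\}$, and let $\zeta_k^{d,n}=1/\sqrt2$ if $|k_{d-2}|=n$ and $\zeta_k^{d,n}=0$ otherwise. For $j\ge1$ let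 $$\Psi^j=\sum_{n=0}^\infty\sum_{k\in\mathcal I_n^d}\sqrt{\dim\mathcal H_n^d}\;\kappa\!\left(\frac n{2^{j-1}}\right)\zeta_k^{d,n}\,Y_k^{d,n},$$ and let $\Psi_{\mathrm C}^j(x)=\Psi^j(g_0^{-1}x)$ be the polynomial curvelets, where $g_0\in SO(d)$ is any rotation with $g_0e^1=e^{d-1}$ and $g_0e^2=e^d$ ($e^1,\dots,e^d$ is the canonical basis of $\mathbb R^d$). Then there is a constant $c_q>0$, which depends only on $\kappa$, $q$ and $d$, such that for every such $g_0$, every $j\ge1$ and every $x=(x_1,\dots,x_d)\in\mathbb S^{d-1}$, $$|\Psi_{\mathrm C}^j(x)|\le\frac{c_q\,2^{j(3d-2)/4}\,|x_d+\mathrm ix_{d-1}|^{2^{j-2}}}{\bigl(1+2^j\,|\mathrm{Arg}(x_d+\mathrm ix_{d-1})|\bigr)^q}.$$ Here $\mathrm{Arg}(z)\in(-\pi,\pi]$ is the principal argument of $z\ne0$, and $\mathrm{Arg}(0)=0$ (for $x_d=x_{d-1}=0$ both sides vanish). -/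

import Mathlib

noncomputable section

namespace Curvelet

/-- `φ ∈ C^q([0, ∞))` is real-valued and non-increasing, with `φ = 1` on `[0, 1/2]` and
`φ = 0` on `[1, ∞)`. (The values of `φ` on the negative half-line are irrelevant.) -/
structure IsCutoff (q : ℕ) (φ : ℝ → ℝ) : Prop where
  contDiffOn : ContDiffOn ℝ q φ (Set.Ici 0)
  antitoneOn : AntitoneOn φ (Set.Ici 0)
  eq_one : ∀ t ∈ Set.Icc (0 : ℝ) (1 / 2), φ t = 1
  eq_zero : ∀ t : ℝ, 1 ≤ t → φ t = 0

/-- The window function `κ(t) = √(φ(t/2)² - φ(t)²)`, `t ≥ 0`. -/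
def window (φ : ℝ → ℝ) (t : ℝ) : ℝ := Real.sqrt (φ (t / 2) ^ 2 - φ t ^ 2)

/-- The unit sphere `S^{d-1} ⊂ ℝ^d`. -/
abbrev Sph (d : ℕ) : Type := Metric.sphere (0 : EuclideanSpace ℝ (Fin d)) 1

/-- The coordinate `x_i`, counted from `1`: `x = (x_1, …, x_d)`. -/
def coord {d : ℕ} (x : EuclideanSpace ℝ (Fin d)) (i : ℕ) : ℝ :=
  if h : 1 ≤ i ∧ i ≤ d then x ⟨i - 1, by omega⟩ else 0

/-- The spherical coordinates `θ_1 ∈ (-π, π]`, `θ_2, …, θ_{d-1} ∈ [0, π]` of a point `x` of the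
sphere, for which
`x_1 = sin θ_{d-1} ⋯ sin θ_2 sin θ_1`, `x_2 = sin θ_{d-1} ⋯ sin θ_2 cos θ_1`, and
`x_m = sin θ_{d-1} ⋯ sin θ_m cos θ_{m-1}` for `3 ≤ m ≤ d`.
Thus `θ_1 = Arg(x_2 + i x_1)` and `cos θ_m = x_{m+1} / √(x_1² + ⋯ + x_{m+1}²)` for `m ≥ 2`. -/
def angle {d : ℕ} (x : EuclideanSpace ℝ (Fin d)) (m : ℕ) : ℝ :=
  if m = 1 then Complex.arg ((coord x 2 : ℂ) + Complex.I * (coord x 1 : ℂ))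
  else Real.arccos
    (coord x (m + 1) / Real.sqrt (∑ i ∈ Finset.Icc 1 (m + 1), coord x i ^ 2))

/-- The Gegenbauer polynomial `C_m^a`, in its usual normalization, by the three-term recurrence
`m C_m^a(t) = 2 (m + a - 1) t C_{m-1}^a(t) - (m + 2 a - 2) C_{m-2}^a(t)`. -/
def gegenbauer (a : ℝ) : ℕ → ℝ → ℝ
  | 0, _ => 1
  | 1, t => 2 * a * t
  | m + 2, t =>
      (2 * ((m : ℝ) + 1 + a) * t * gegenbauer a (m + 1) t
        - ((m : ℝ) + 2 * a) * gegenbauer a m t) / ((m : ℝ) + 2)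

/-- The sequence `k_0 = n, k_1, …, k_{d-2}` attached to `n` and `k = (k_1, …, k_{d-2})`. -/
def idx (d n : ℕ) (k : Fin (d - 2) → ℤ) : ℕ → ℤ
  | 0 => n
  | i + 1 => if h : i < d - 2 then k ⟨i, h⟩ else 0

/-- The index set `I_n^d` of all integer tuples `k = (k_1, …, k_{d-2})` with
`n ≥ k_1 ≥ ⋯ ≥ k_{d-3} ≥ |k_{d-2}|`. This is the condition `|k_{j+1}| ≤ k_j` for
`0 ≤ j ≤ d - 3`, where `k_0 = n`; it forces `k_1, …, k_{d-3}` to be non-negative. -/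
def indexSet (d n : ℕ) : Finset (Fin (d - 2) → ℤ) :=
  (Fintype.piFinset fun _ => Finset.Icc (-(n : ℤ)) n).filter
    fun k : Fin (d - 2) → ℤ => ∀ j : Fin (d - 2), |idx d n k (j.val + 1)| ≤ idx d n k j.val

/-- The normalization constant `A_k^n > 0`, the root of
`2^{(d-4)(d-2)} / Γ(d/2) ·
∏_{j=0}^{d-3} 2^{2|k_{j+1}| - j} (k_j - |k_{j+1}|)! (2 k_j + d - j - 2) Γ((d-j-2)/2 + |k_{j+1}|)²
  / (√π Γ(k_j + |k_{j+1}| + d - j - 2))`. -/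
def normConst (d n : ℕ) (k : Fin (d - 2) → ℤ) : ℝ :=
  Real.sqrt
    ((2 : ℝ) ^ (((d : ℤ) - 4) * ((d : ℤ) - 2)) / Real.Gamma ((d : ℝ) / 2) *
      ∏ j ∈ Finset.range (d - 2),
        (2 : ℝ) ^ (2 * |idx d n k (j + 1)| - (j : ℤ))
          * ((idx d n k j - |idx d n k (j + 1)|).toNat.factorial : ℝ)
          * (2 * (idx d n k j : ℝ) + d - j - 2)
          * Real.Gamma (((d : ℝ) - j - 2) / 2 + (|idx d n k (j + 1)| : ℤ)) ^ 2
          / (Real.sqrt Real.pi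
              * Real.Gamma ((idx d n k j : ℝ) + (|idx d n k (j + 1)| : ℤ) + d - j - 2)))

/-- The spherical harmonic `Y_k^{d,n}`, given in the spherical coordinates of the point by
`A_k^n ∏_{j=0}^{d-3} C_{k_j - |k_{j+1}|}^{(d-j-2)/2 + |k_{j+1}|}(cos θ_{d-j-1})
  sin^{|k_{j+1}|}(θ_{d-j-1}) · e^{i k_{d-2} θ_1}`. -/
def sphHarmonic (d n : ℕ) (k : Fin (d - 2) → ℤ) (x : Sph d) : ℂ :=
  ((normConst d n k *
      ∏ j ∈ Finset.range (d - 2),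
        (gegenbauer (((d : ℝ) - j - 2) / 2 + (|idx d n k (j + 1)| : ℤ))
            (idx d n k j - |idx d n k (j + 1)|).toNat
            (Real.cos (angle x.1 (d - j - 1)))
          * Real.sin (angle x.1 (d - j - 1)) ^ (idx d n k (j + 1)).natAbs) : ℝ) : ℂ)
    * Complex.exp (Complex.I * (idx d n k (d - 2) : ℂ) * (angle x.1 1 : ℂ))

/-- The space `H_n^d` of spherical harmonics of degree `n`, the span of the `Y_k^{d,n}`,
`k ∈ I_n^d`. -/
def harmonicSpace (d n : ℕ) : Submodule ℂ (Sph d → ℂ) :=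
  Submodule.span ℂ ((fun k => sphHarmonic d n k) '' (indexSet d n : Set (Fin (d - 2) → ℤ)))

/-- The directionality component `ζ_k^{d,n}`: equal to `1/√2` if `|k_{d-2}| = n`, and `0`
otherwise. -/
def directionality (d n : ℕ) (k : Fin (d - 2) → ℤ) : ℝ :=
  (1 / Real.sqrt 2) * if |idx d n k (d - 2)| = (n : ℤ) then 1 else 0

/-- The functions `Ψ^j` before rotation: `Ψ^0 = 1` and, for `j ≥ 1`,
`Ψ^j = ∑_{n ≥ 0} ∑_{k ∈ I_n^d} √(dim H_n^d) κ(n / 2^{j-1}) ζ_k^{d,n} Y_k^{d,n}`.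
Since `κ` vanishes on `[2, ∞)`, only finitely many `n` contribute. -/
def initialCurvelet (d : ℕ) (κ : ℝ → ℝ) : ℕ → Sph d → ℂ
  | 0, _ => 1
  | j + 1, x =>
      ∑' n : ℕ, ∑ k ∈ indexSet d n,
        ((Real.sqrt (Module.finrank ℂ (harmonicSpace d n)) * κ ((n : ℝ) / 2 ^ j)
            * directionality d n k : ℝ) : ℂ) * sphHarmonic d n k x

theorem rotate_mem {d : ℕ} (g : Matrix.specialOrthogonalGroup (Fin d) ℝ) (x : Sph d) :
    WithLp.toLp 2 ((g : Matrix (Fin d) (Fin d) ℝ).mulVec x.1.ofLp)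
      ∈ Metric.sphere (0 : EuclideanSpace ℝ (Fin d)) 1 := by
  have hg : (g : Matrix (Fin d) (Fin d) ℝ).transpose * (g : Matrix (Fin d) (Fin d) ℝ) = 1 :=
    (Matrix.mem_orthogonalGroup_iff' (Fin d) ℝ).1
      (Matrix.mem_specialOrthogonalGroup_iff.1 g.2).1
  have hx : ‖x.1‖ = 1 := by simp
  have hd : ∀ v : Fin d → ℝ, ‖(WithLp.toLp 2 v : EuclideanSpace ℝ (Fin d))‖ ^ 2 = v ⬝ᵥ v := by
    intro v
    rw [EuclideanSpace.norm_sq_eq]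
    simp [dotProduct, sq]
  have h2 : ‖(WithLp.toLp 2 ((g : Matrix (Fin d) (Fin d) ℝ).mulVec x.1.ofLp) :
      EuclideanSpace ℝ (Fin d))‖ ^ 2 = 1 := by
    rw [hd, Matrix.dotProduct_mulVec, ← Matrix.mulVec_transpose, Matrix.mulVec_mulVec, hg,
      Matrix.one_mulVec, ← hd]
    simp [hx]
  rw [mem_sphere_zero_iff_norm]
  exact (pow_eq_one_iff_of_nonneg (norm_nonneg _) two_ne_zero).1 h2

/-- The action of `g ∈ SO(d)` on the sphere, `x ↦ g x`. -/
def rotate {d : ℕ} (g : Matrix.specialOrthogonalGroup (Fin d) ℝ) (x : Sph d) : Sph d :=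
  ⟨WithLp.toLp 2 ((g : Matrix (Fin d) (Fin d) ℝ).mulVec x.1.ofLp), rotate_mem g x⟩

/-- The polynomial curvelets `Ψ_C^j(x) = Ψ^j(g₀⁻¹ x)`. -/
def curvelet (d : ℕ) (κ : ℝ → ℝ) (g₀ : Matrix.specialOrthogonalGroup (Fin d) ℝ) (j : ℕ)
    (x : Sph d) : ℂ :=
  initialCurvelet d κ j (rotate g₀⁻¹ x)

end Curvelet

end

/-!
The condition `|k_{d-2}| = n` forces `k = (n, …, n, ±n)`. Then all Gegenbauer factors have degree
`0`, the product of the sines telescopes, and `Y_k^{d,n}` is the multiple `A_n (x_2 ± i x_1)^n` of a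
power of one complex variable (`sphHarmonic_topIndex`). After the rotation that variable is
`z = x_d + i x_{d-1}`, so a curvelet is `√2` times the real part of `∑_n a_n z^n`, where
`a_n = √(dim H_n^d) A_n κ(n / 2^{j-1})` is supported in `2^{j-2} < n < 2^j`
(`initialCurvelet_succ`).

The bound is then summation by parts. With `Δ` the forward difference,
`(1 - z)^q ∑ a_n z^n = z^q ∑ (Δ^q a)_n z^n` (`one_sub_pow_mul_sum`), and `|Arg z| ≤ π |1 - z|`; the
support of `a` gives the factor `|z|^{2^{j-2}}`. It remains to see that `Δ^q a` has size
`2^{j (s - q)}` with `s = 3 (d - 2) / 4`, that is, that `a` is a discrete symbol of order `s`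
uniformly in `j` (`IsSymbol`). Such symbols form an algebra, stable under inverses and square roots
of elliptic ones, and the factors of `a` are treated separately:

* the dilates of the `C^q` function `κ` are symbols of order `0` (`IsCutoff.isSymbol_window`);
* by the duplication formula `A_n^2` is a constant times a product of `d - 2` quotients
  `Γ(x + 1) / Γ(x + 1/2)` with `x - n` constant (`normConst_topIndex`), each a symbol of
  order `1/2`: log-convexity of `Γ` gives its size, the functional equation its differences
  (`isSymbol_gammaQuot`);
* `dim H_n^d` is a product of linear polynomials in `n`, hence a symbol of order `d - 2`. This uses
  that the `Y_k^{d,n}` are linearly independent (`linearIndependent_sphHarmonic`), which is proved by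
  separating the variables, so that `dim H_n^d` is the number of indices
  (`factorial_mul_card_indexSet`).
-/

namespace Curvelet

/-! ### Discrete symbols -/

section Symbols

/-- A family `a i`, `i : ι`, of real sequences is a symbol of order `m`, with control of `k`
differences, if `|Δ^b (a i) n| ≤ C (n + 1)^(m - b)` for all `b ≤ k`, with `C` independent of `i`
and `n`. The weight is `n + 1` rather than `n`, so that `n = 0` needs no exception. -/
def IsSymbol {ι : Type*} (k : ℕ) (m : ℝ) (a : ι → ℕ → ℝ) : Prop :=
  ∀ b ≤ k, ∃ C : ℝ, ∀ i (n : ℕ), |(fwdDiff 1)^[b] (a i) n| ≤ C * ((n : ℝ) + 1) ^ (m - b)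

/-- A family of sequences is elliptic of order `m` if it is bounded below by `c (n + 1)^m`, with
some `c > 0` independent of the member of the family. -/
def IsElliptic {ι : Type*} (m : ℝ) (a : ι → ℕ → ℝ) : Prop :=
  ∃ c : ℝ, 0 < c ∧ ∀ i (n : ℕ), c * ((n : ℝ) + 1) ^ m ≤ a i n

variable {ι : Type*} {k : ℕ} {m l : ℝ} {a b : ι → ℕ → ℝ}

theorem isSymbol_zero_iff :
    IsSymbol 0 m a ↔ ∃ C : ℝ, ∀ i (n : ℕ), |a i n| ≤ C * ((n : ℝ) + 1) ^ m := by
  simp [IsSymbol]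

theorem isSymbol_succ_iff :
    IsSymbol (k + 1) m a ↔ IsSymbol 0 m a ∧ IsSymbol k (m - 1) (fun i => fwdDiff 1 (a i)) := by
  constructor
  · refine fun h => ⟨fun b hb => h b (by omega), fun b hb => ?_⟩
    obtain ⟨C, hC⟩ := h (b + 1) (by omega)
    refine ⟨C, fun i n => ?_⟩
    have := hC i n
    rw [Function.iterate_succ_apply] at this
    convert this using 3
    push_cast; ring
  · rintro ⟨h0, h1⟩ (_ | b) hb
    · exact h0 0 le_rfl
    · obtain ⟨C, hC⟩ := h1 b (by omega)
      refine ⟨C, fun i n => ?_⟩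
      have := hC i n
      rw [Function.iterate_succ_apply]
      convert this using 3
      push_cast; ring

theorem IsSymbol.congr (h : IsSymbol k m a) (hab : ∀ i n, a i n = b i n) : IsSymbol k m b := by
  rwa [show b = a from funext fun i => funext fun n => (hab i n).symm]

theorem IsSymbol.mono {k' : ℕ} (h : IsSymbol k m a) (hk : k' ≤ k) : IsSymbol k' m a :=
  fun b hb => h b (hb.trans hk)

theorem IsSymbol.add (ha : IsSymbol k m a) (hb : IsSymbol k m b) :
    IsSymbol k m (fun i n => a i n + b i n) := by
  intro r hr
  obtain ⟨C, hC⟩ := ha r hr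
  obtain ⟨D, hD⟩ := hb r hr
  refine ⟨C + D, fun i n => ?_⟩
  have : (fun n => a i n + b i n) = a i + b i := rfl
  dsimp only
  rw [this, fwdDiff_iter_add, Pi.add_apply, add_mul]
  exact (abs_add_le _ _).trans (add_le_add (hC i n) (hD i n))

theorem IsSymbol.const_mul (c : ℝ) (ha : IsSymbol k m a) :
    IsSymbol k m (fun i n => c * a i n) := by
  intro r hr
  obtain ⟨C, hC⟩ := ha r hr
  refine ⟨|c| * C, fun i n => ?_⟩
  have : (fun n => c * a i n) = c • a i := rfl
  dsimp only
  rw [this, fwdDiff_iter_const_smul, Pi.smul_apply, smul_eq_mul, abs_mul, mul_assoc]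
  exact mul_le_mul_of_nonneg_left (hC i n) (abs_nonneg c)

theorem IsSymbol.neg (ha : IsSymbol k m a) : IsSymbol k m (fun i n => -a i n) := by
  simpa using ha.const_mul (-1)

theorem rpow_shift_le (m : ℝ) (n : ℕ) :
    ((n : ℝ) + 1 + 1) ^ m ≤ 2 ^ |m| * ((n : ℝ) + 1) ^ m := by
  have hn : (0 : ℝ) < n + 1 := by positivity
  rcases le_total 0 m with hm | hm
  · rw [abs_of_nonneg hm, ← Real.mul_rpow (by norm_num) hn.le]
    exact Real.rpow_le_rpow (by positivity) (by linarith) hm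
  · calc ((n : ℝ) + 1 + 1) ^ m ≤ ((n : ℝ) + 1) ^ m :=
          Real.rpow_le_rpow_of_nonpos hn (by linarith) hm
      _ ≤ _ := le_mul_of_one_le_left (by positivity)
          (Real.one_le_rpow (by norm_num) (abs_nonneg m))

theorem IsSymbol.shift (ha : IsSymbol k m a) : IsSymbol k m (fun i n => a i (n + 1)) := by
  intro r hr
  obtain ⟨C, hC⟩ := ha r hr
  refine ⟨|C| * 2 ^ |m - r|, fun i n => ?_⟩
  rw [fwdDiff_iter_comp_add 1 (a i) 1 r n]
  refine (hC i (n + 1)).trans ?_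
  push_cast
  rw [mul_assoc]
  exact mul_le_mul (le_abs_self C) (rpow_shift_le _ _) (by positivity) (abs_nonneg C)

theorem fwdDiff_mul_eq (f g : ℕ → ℝ) (n : ℕ) :
    fwdDiff 1 (fun n => f n * g n) n = f (n + 1) * fwdDiff 1 g n + fwdDiff 1 f n * g n := by
  simp only [fwdDiff]; ring

theorem IsSymbol.mul (ha : IsSymbol k m a) (hb : IsSymbol k l b) :
    IsSymbol k (m + l) (fun i n => a i n * b i n) := by
  induction k generalizing m l a b with
  | zero =>
    rw [isSymbol_zero_iff] at *
    obtain ⟨C, hC⟩ := ha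
    obtain ⟨D, hD⟩ := hb
    refine ⟨C * D, fun i n => ?_⟩
    rw [abs_mul, Real.rpow_add (by positivity), mul_mul_mul_comm]
    exact mul_le_mul (hC i n) (hD i n) (abs_nonneg _) ((abs_nonneg _).trans (hC i n))
  | succ k ih =>
    obtain ⟨ha0, ha1⟩ := isSymbol_succ_iff.1 ha
    obtain ⟨hb0, hb1⟩ := isSymbol_succ_iff.1 hb
    refine isSymbol_succ_iff.2 ⟨?_, ?_⟩
    · rw [isSymbol_zero_iff] at *
      obtain ⟨C, hC⟩ := ha0
      obtain ⟨D, hD⟩ := hb0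
      refine ⟨C * D, fun i n => ?_⟩
      rw [abs_mul, Real.rpow_add (by positivity), mul_mul_mul_comm]
      exact mul_le_mul (hC i n) (hD i n) (abs_nonneg _) ((abs_nonneg _).trans (hC i n))
    · have h1 := ih (ha.mono k.le_succ).shift hb1
      have h2 := ih ha1 (hb.mono k.le_succ)
      rw [show m + (l - 1) = m + l - 1 by ring] at h1
      rw [show m - 1 + l = m + l - 1 by ring] at h2
      exact (h1.add h2).congr fun i n => (fwdDiff_mul_eq _ _ n).symm

theorem isSymbol_const (k : ℕ) (c : ℝ) : IsSymbol k 0 (fun (_ : ι) _ => c) := by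
  rintro (_ | r) -
  · exact ⟨|c|, fun i n => by simp⟩
  · refine ⟨0, fun i n => ?_⟩
    rw [Function.iterate_succ_apply, fwdDiff_const]
    have : ∀ r : ℕ, (fwdDiff 1)^[r] (fun _ : ℕ => (0 : ℝ)) = fun _ => 0 := fun r => by
      induction r with
      | zero => rfl
      | succ r ih => rw [Function.iterate_succ_apply, fwdDiff_const, ih]
    rw [this]; simp

theorem IsSymbol.prod {κ : Type*} (s : Finset κ) {f : κ → ι → ℕ → ℝ}
    (h : ∀ j ∈ s, IsSymbol k m (f j)) :
    IsSymbol k (s.card * m) (fun i n => ∏ j ∈ s, f j i n) := by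
  classical
  induction s using Finset.induction_on with
  | empty => simpa using isSymbol_const k 1
  | insert j s hj ih =>
    have h1 := (h j (by simp)).mul (ih fun i hi => h i (by simp [hi]))
    simp_rw [Finset.prod_insert hj, Finset.card_insert_of_notMem hj]
    convert h1 using 1
    push_cast; ring

theorem IsElliptic.pos (h : IsElliptic m a) (i : ι) (n : ℕ) : 0 < a i n := by
  obtain ⟨c, hc, hca⟩ := h
  exact lt_of_lt_of_le (by positivity) (hca i n)

theorem IsElliptic.mul (ha : IsElliptic m a) (hb : IsElliptic l b) :
    IsElliptic (m + l) (fun i n => a i n * b i n) := by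
  have hpos := ha.pos
  obtain ⟨c, hc, hca⟩ := ha
  obtain ⟨d, hd, hdb⟩ := hb
  refine ⟨c * d, by positivity, fun i n => ?_⟩
  rw [Real.rpow_add (by positivity), mul_mul_mul_comm]
  exact mul_le_mul (hca i n) (hdb i n) (by positivity) (hpos i n).le

theorem isElliptic_const {c : ℝ} (hc : 0 < c) : IsElliptic 0 (fun (_ : ι) _ => c) :=
  ⟨c, hc, fun i n => by simp⟩

theorem IsElliptic.prod {κ : Type*} (s : Finset κ) {f : κ → ι → ℕ → ℝ}
    (h : ∀ j ∈ s, IsElliptic m (f j)) :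
    IsElliptic (s.card * m) (fun i n => ∏ j ∈ s, f j i n) := by
  classical
  induction s using Finset.induction_on with
  | empty => simpa using isElliptic_const (ι := ι) one_pos
  | insert j s hj ih =>
    have h1 := (h j (by simp)).mul (ih fun i hi => h i (by simp [hi]))
    simp_rw [Finset.prod_insert hj, Finset.card_insert_of_notMem hj]
    convert h1 using 1
    push_cast; ring

theorem IsElliptic.sqrt (ha : IsElliptic m a) :
    IsElliptic (m / 2) (fun i n => √(a i n)) := by
  obtain ⟨c, hc, hca⟩ := ha
  refine ⟨√c, by positivity, fun i n => ?_⟩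
  have : ((n : ℝ) + 1) ^ (m / 2) = √(((n : ℝ) + 1) ^ m) := by
    rw [Real.sqrt_eq_rpow, ← Real.rpow_mul (by positivity)]; ring_nf
  rw [this, ← Real.sqrt_mul hc.le]
  exact Real.sqrt_le_sqrt (hca i n)

theorem IsElliptic.isSymbol_inv_zero (ha : IsElliptic m a) :
    IsSymbol 0 (-m) (fun i n => (a i n)⁻¹) := by
  rw [isSymbol_zero_iff]
  have hpos := ha.pos
  obtain ⟨c, hc, hca⟩ := ha
  refine ⟨c⁻¹, fun i n => ?_⟩
  rw [Real.rpow_neg (by positivity), ← mul_inv, abs_of_pos (inv_pos.2 (hpos i n))]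
  exact inv_anti₀ (by positivity) (hca i n)

theorem IsSymbol.inv (ha : IsSymbol k m a) (he : IsElliptic m a) :
    IsSymbol k (-m) (fun i n => (a i n)⁻¹) := by
  induction k with
  | zero => exact he.isSymbol_inv_zero
  | succ k ih =>
    refine isSymbol_succ_iff.2 ⟨he.isSymbol_inv_zero, ?_⟩
    have h1 := ih (ha.mono k.le_succ)
    have h2 := ((isSymbol_succ_iff.1 ha).2.neg.mul h1).mul h1.shift
    rw [show m - 1 + -m + -m = -m - 1 by ring] at h2
    refine h2.congr fun i n => ?_
    have := (he.pos i n).ne'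
    have := (he.pos i (n + 1)).ne'
    simp only [fwdDiff]
    field_simp
    ring

theorem IsSymbol.sqrt (ha : IsSymbol k m a) (he : IsElliptic m a) :
    IsSymbol k (m / 2) (fun i n => √(a i n)) := by
  have h0 : IsSymbol 0 (m / 2) (fun i n => √(a i n)) := by
    obtain ⟨C, hC⟩ := isSymbol_zero_iff.1 (ha.mono k.zero_le)
    refine isSymbol_zero_iff.2 ⟨√|C|, fun i n => ?_⟩
    have : ((n : ℝ) + 1) ^ (m / 2) = √(((n : ℝ) + 1) ^ m) := by
      rw [Real.sqrt_eq_rpow, ← Real.rpow_mul (by positivity)]; ring_nf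
    rw [this, ← Real.sqrt_mul (abs_nonneg C), abs_of_nonneg (Real.sqrt_nonneg _)]
    refine Real.sqrt_le_sqrt ((le_abs_self _).trans ((hC i n).trans ?_))
    exact mul_le_mul_of_nonneg_right (le_abs_self C) (by positivity)
  induction k with
  | zero => exact h0
  | succ k ih =>
    refine isSymbol_succ_iff.2 ⟨h0, ?_⟩
    have h1 := ih (ha.mono k.le_succ)
    have hell : IsElliptic (m / 2) (fun i n => √(a i n) + √(a i (n + 1))) := by
      obtain ⟨c, hc, hca⟩ := he.sqrt
      exact ⟨c, hc, fun i n => (hca i n).trans (le_add_of_nonneg_right (Real.sqrt_nonneg _))⟩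
    have h2 := (isSymbol_succ_iff.1 ha).2.mul ((h1.add h1.shift).inv hell)
    rw [show m - 1 + -(m / 2) = m / 2 - 1 by ring] at h2
    refine h2.congr fun i n => ?_
    have := (hell.pos i n).ne'
    simp only [fwdDiff]
    field_simp
    nlinarith [Real.sq_sqrt (he.pos i n).le, Real.sq_sqrt (he.pos i (n + 1)).le]

/-- A sequence with `Δ a = a ρ`, `ρ` a symbol of order `-1`, is a symbol of any order that its size
allows. -/
theorem IsSymbol.of_fwdDiff_eq_mul {ρ : ι → ℕ → ℝ} (h0 : IsSymbol 0 m a)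
    (hρ : IsSymbol k (-1) ρ) (h : ∀ i n, a i (n + 1) - a i n = a i n * ρ i n) :
    IsSymbol k m a := by
  induction k with
  | zero => exact h0
  | succ k ih =>
    refine isSymbol_succ_iff.2 ⟨h0, ?_⟩
    have h1 := (ih (hρ.mono k.le_succ)).mul (hρ.mono k.le_succ)
    rw [← sub_eq_add_neg] at h1
    exact h1.congr fun i n => (h i n).symm

theorem isElliptic_linear {s c : ℝ} (hs : 0 < s) (hc : 0 < c) :
    IsElliptic 1 (fun (_ : ι) (n : ℕ) => s * n + c) := by
  refine ⟨min s c, lt_min hs hc, fun i n => ?_⟩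
  rw [Real.rpow_one, mul_add, mul_one]
  exact add_le_add (mul_le_mul_of_nonneg_right (min_le_left _ _) n.cast_nonneg) (min_le_right _ _)

theorem isSymbol_linear (k : ℕ) {s c : ℝ} (hs : 0 < s) (hc : 0 < c) :
    IsSymbol k 1 (fun (_ : ι) (n : ℕ) => s * n + c) := by
  have h0 : IsSymbol 0 1 (fun (_ : ι) (n : ℕ) => s * n + c) := by
    refine isSymbol_zero_iff.2 ⟨max s c, fun i n => ?_⟩
    rw [abs_of_pos (by positivity), Real.rpow_one, mul_add, mul_one]
    exact add_le_add (mul_le_mul_of_nonneg_right (le_max_left _ _) n.cast_nonneg)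
      (le_max_right _ _)
  rcases k with _ | k
  · exact h0
  · refine isSymbol_succ_iff.2 ⟨h0, ?_⟩
    rw [sub_self]
    refine (isSymbol_const (ι := ι) k s).congr fun i n => ?_
    simp only [fwdDiff]; push_cast; ring

/-- Log-convexity of the Gamma function at the midpoint of `x` and `x + 1`. -/
theorem Gamma_add_half_sq_le {x : ℝ} (hx : 0 < x) :
    Real.Gamma (x + 1 / 2) ^ 2 ≤ x * Real.Gamma x ^ 2 := by
  have h := Real.Gamma_mul_add_mul_le_rpow_Gamma_mul_rpow_Gamma hx (by linarith : 0 < x + 1)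
    (by norm_num : (0 : ℝ) < 1 / 2) (by norm_num : (0 : ℝ) < 1 / 2) (by norm_num)
  rw [show 1 / 2 * x + 1 / 2 * (x + 1) = x + 1 / 2 by ring, ← Real.sqrt_eq_rpow,
    ← Real.sqrt_eq_rpow, Real.Gamma_add_one hx.ne'] at h
  have hG := Real.Gamma_pos_of_pos hx
  have hG' := Real.Gamma_pos_of_pos (by linarith : 0 < x + 1 / 2)
  calc Real.Gamma (x + 1 / 2) ^ 2 ≤ (√(Real.Gamma x) * √(x * Real.Gamma x)) ^ 2 :=
        pow_le_pow_left₀ hG'.le h 2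
    _ = _ := by rw [mul_pow, Real.sq_sqrt hG.le, Real.sq_sqrt (by positivity)]; ring

/-- The quotient `Γ(x + 1) / Γ(x + 1/2)`, which grows like `√x`. -/
noncomputable def gammaQuot (x : ℝ) : ℝ := Real.Gamma (x + 1) / Real.Gamma (x + 1 / 2)

theorem gammaQuot_pos {x : ℝ} (hx : 0 < x) : 0 < gammaQuot x :=
  div_pos (Real.Gamma_pos_of_pos (by linarith)) (Real.Gamma_pos_of_pos (by linarith))

theorem gammaQuot_sq_le {x : ℝ} (hx : 0 < x) : gammaQuot x ^ 2 ≤ x + 1 / 2 := by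
  have h := Gamma_add_half_sq_le (by linarith : 0 < x + 1 / 2)
  have hG := Real.Gamma_pos_of_pos (by linarith : 0 < x + 1 / 2)
  rw [show x + 1 / 2 + 1 / 2 = x + 1 by ring] at h
  rw [gammaQuot, div_pow, div_le_iff₀ (by positivity)]
  exact h

theorem le_gammaQuot_sq {x : ℝ} (hx : 0 < x) : x ≤ gammaQuot x ^ 2 := by
  have h := Gamma_add_half_sq_le hx
  have hG := Real.Gamma_pos_of_pos (by linarith : 0 < x + 1 / 2)
  rw [gammaQuot, div_pow, le_div_iff₀ (by positivity), Real.Gamma_add_one hx.ne']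
  nlinarith

theorem gammaQuot_add_one {x : ℝ} (hx : 0 < x) :
    gammaQuot (x + 1) = gammaQuot x * ((x + 1) / (x + 1 / 2)) := by
  have hG := Real.Gamma_pos_of_pos (by linarith : 0 < x + 1 / 2)
  rw [gammaQuot, gammaQuot, Real.Gamma_add_one (by linarith : x + 1 ≠ 0),
    show x + 1 + 1 / 2 = x + 1 / 2 + 1 by ring,
    Real.Gamma_add_one (by linarith : x + 1 / 2 ≠ 0)]
  field_simp

theorem isElliptic_gammaQuot {β : ℝ} (hβ : 0 < β) :
    IsElliptic (1 / 2) (fun (_ : ι) (n : ℕ) => gammaQuot (n + β)) := by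
  obtain ⟨c, hc, hca⟩ := (isElliptic_linear (ι := ι) one_pos hβ).sqrt
  refine ⟨c, hc, fun i n => (hca i n).trans ?_⟩
  have hx : 0 < (n : ℝ) + β := by positivity
  dsimp only
  rw [one_mul, Real.sqrt_le_left (gammaQuot_pos hx).le]
  exact le_gammaQuot_sq hx

theorem isSymbol_gammaQuot (k : ℕ) {β : ℝ} (hβ : 0 < β) :
    IsSymbol k (1 / 2) (fun (_ : ι) (n : ℕ) => gammaQuot (n + β)) := by
  have hlin : 0 < 2 * β + 1 := by positivity
  have hρ := (isSymbol_linear (ι := ι) k two_pos hlin).inv (isElliptic_linear two_pos hlin)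
  refine IsSymbol.of_fwdDiff_eq_mul ?_ hρ fun i n => ?_
  · have hβ' : 0 < β + 1 / 2 := by positivity
    obtain ⟨C, hC⟩ := isSymbol_zero_iff.1
      ((isSymbol_linear (ι := ι) 0 one_pos hβ').sqrt (isElliptic_linear one_pos hβ'))
    refine isSymbol_zero_iff.2 ⟨C, fun i n => le_trans ?_ (hC i n)⟩
    have hx : 0 < (n : ℝ) + β := by positivity
    rw [abs_of_pos (gammaQuot_pos hx), abs_of_nonneg (Real.sqrt_nonneg _)]
    refine Real.le_sqrt_of_sq_le ((gammaQuot_sq_le hx).trans (by linarith))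
  · have hx : 0 < (n : ℝ) + β := by positivity
    push_cast
    rw [show (n : ℝ) + 1 + β = n + β + 1 by ring, gammaQuot_add_one hx]
    field_simp
    ring

end Symbols

/-! ### Differences of the window function -/

theorem hasDerivAt_fwdDiff_iter {h : ℝ} (b : ℕ) {f : ℝ → ℝ} (hf : Differentiable ℝ f) (t : ℝ) :
    HasDerivAt ((fwdDiff h)^[b] f) ((fwdDiff h)^[b] (deriv f) t) t := by
  induction b generalizing f with
  | zero => exact (hf t).hasDerivAt
  | succ b ih =>
    have h1 : ∀ s, HasDerivAt (fwdDiff h f) (fwdDiff h (deriv f) s) s := fun s => by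
      have := (hf (s + h)).hasDerivAt.comp_add_const s h
      exact this.sub (hf s).hasDerivAt
    have h2 : deriv (fwdDiff h f) = fwdDiff h (deriv f) := funext fun s => (h1 s).deriv
    rw [Function.iterate_succ_apply, Function.iterate_succ_apply, ← h2]
    exact ih fun s => (h1 s).differentiableAt

/-- Iterated differences with step `h` are bounded by `h ^ b` times a bound of the `b`-th
derivative. -/
theorem abs_fwdDiff_iter_le {h M : ℝ} (hh : 0 ≤ h) (b : ℕ) {f : ℝ → ℝ} (hf : ContDiff ℝ b f)
    (hM : ∀ t, |iteratedDeriv b f t| ≤ M) (t : ℝ) : |(fwdDiff h)^[b] f t| ≤ M * h ^ b := by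
  induction b generalizing f t with
  | zero => simpa using hM t
  | succ b ih =>
    have hd : Differentiable ℝ f := hf.differentiable (by simp)
    have hf' : ContDiff ℝ b (deriv f) := by
      have : ContDiff ℝ ((b : WithTop ℕ∞) + 1) f := by exact_mod_cast hf
      exact (contDiff_succ_iff_deriv.1 this).2.2
    have hbound := ih hf' fun t => by rw [← iteratedDeriv_succ']; exact hM t
    rw [Function.iterate_succ_apply']
    have := (convex_univ (𝕜 := ℝ)).norm_image_sub_le_of_norm_hasDerivWithin_le
      (fun x _ => (hasDerivAt_fwdDiff_iter (h := h) b hd x).hasDerivWithinAt)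
      (fun x _ => hbound x) (Set.mem_univ t) (Set.mem_univ (t + h))
    rw [fwdDiff, ← Real.norm_eq_abs]
    refine this.trans_eq ?_
    rw [add_sub_cancel_left, Real.norm_of_nonneg hh, pow_succ, mul_assoc]

theorem fwdDiff_iter_comp_mul (f : ℝ → ℝ) (h : ℝ) (b n : ℕ) :
    (fwdDiff 1)^[b] (fun n : ℕ => f (n * h)) n = (fwdDiff h)^[b] f (n * h) := by
  induction b generalizing f with
  | zero => rfl
  | succ b ih =>
    have : fwdDiff 1 (fun n : ℕ => f (n * h)) = fun n : ℕ => fwdDiff h f (n * h) := by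
      funext n
      simp only [fwdDiff]
      push_cast; ring_nf
    rw [Function.iterate_succ_apply, Function.iterate_succ_apply, ← ih, this]

theorem fwdDiff_iter_eq_zero_of_le {f : ℕ → ℝ} {N : ℕ} (hf : ∀ n, N ≤ n → f n = 0) (b : ℕ) :
    ∀ n, N ≤ n → (fwdDiff 1)^[b] f n = 0 := by
  induction b generalizing f with
  | zero => exact hf
  | succ b ih =>
    rw [Function.iterate_succ_apply]
    exact ih fun n hn => by simp [fwdDiff, hf n hn, hf (n + 1) (by omega)]

theorem fwdDiff_iter_eq_zero_of_add_le {f : ℕ → ℝ} {x : ℝ} (hf : ∀ n : ℕ, (n : ℝ) ≤ x → f n = 0)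
    (b : ℕ) : ∀ n : ℕ, (n : ℝ) + b ≤ x → (fwdDiff 1)^[b] f n = 0 := by
  induction b generalizing f x with
  | zero => intro n hn; exact hf n (by simpa using hn)
  | succ b ih =>
    intro n hn
    rw [Function.iterate_succ_apply]
    refine ih (x := x - 1) (fun k hk => ?_) n (by push_cast at hn; linarith)
    simp [fwdDiff, hf k (by linarith), hf (k + 1) (by push_cast; linarith)]

section Window

variable {q : ℕ} {φ : ℝ → ℝ}

theorem IsCutoff.window_eq_zero_of_le (hφ : IsCutoff q φ) {t : ℝ} (h0 : 0 ≤ t) (ht : t ≤ 1 / 2) :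
    window φ t = 0 := by
  rw [window, hφ.eq_one t ⟨h0, ht⟩, hφ.eq_one (t / 2) ⟨by linarith, by linarith⟩]
  simp

theorem IsCutoff.window_eq_zero_of_ge (hφ : IsCutoff q φ) {t : ℝ} (ht : 2 ≤ t) :
    window φ t = 0 := by
  rw [window, hφ.eq_zero t (by linarith), hφ.eq_zero (t / 2) (by linarith)]
  simp

/-- The window function, extended by zero to the negative half-line, is `C^q` on `ℝ`. -/
theorem IsCutoff.contDiff_indicator_window (hφ : IsCutoff q φ)
    (hκ : ContDiffOn ℝ q (window φ) (Set.Ici 0)) :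
    ContDiff ℝ q ((Set.Ici 0).indicator (window φ)) := by
  refine contDiff_iff_contDiffAt.2 fun t => ?_
  rcases lt_or_ge t (1 / 2) with ht | ht
  · refine (contDiffAt_const (c := (0 : ℝ))).congr_of_eventuallyEq ?_
    filter_upwards [Iio_mem_nhds ht] with s hs
    by_cases h : s ∈ Set.Ici (0 : ℝ)
    · rw [Set.indicator_of_mem h, hφ.window_eq_zero_of_le h (le_of_lt hs)]
    · rw [Set.indicator_of_notMem h]
  · have hmem : Set.Ici (0 : ℝ) ∈ nhds t := Ici_mem_nhds (by linarith)
    refine (hκ.contDiffAt hmem).congr_of_eventuallyEq ?_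
    filter_upwards [hmem] with s hs
    rw [Set.indicator_of_mem hs]

theorem IsCutoff.exists_bound_iteratedDeriv (hφ : IsCutoff q φ)
    (hκ : ContDiffOn ℝ q (window φ) (Set.Ici 0)) {b : ℕ} (hb : b ≤ q) :
    ∃ M, ∀ t, |iteratedDeriv b ((Set.Ici 0).indicator (window φ)) t| ≤ M := by
  have hK := hφ.contDiff_indicator_window hκ
  have hsupp : HasCompactSupport ((Set.Ici 0).indicator (window φ)) :=
    HasCompactSupport.intro (isCompact_Icc (a := (0 : ℝ)) (b := 2)) fun t ht => by
      by_cases h : t ∈ Set.Ici (0 : ℝ)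
      · rw [Set.indicator_of_mem h]
        refine hφ.window_eq_zero_of_ge (le_of_not_gt fun h2 => ht ⟨h, h2.le⟩)
      · rw [Set.indicator_of_notMem h]
  have hc := hK.continuous_iteratedDeriv b (by exact_mod_cast hb)
  have hs : HasCompactSupport (iteratedDeriv b ((Set.Ici 0).indicator (window φ))) := by
    clear hc hb
    induction b with
    | zero => simpa using hsupp
    | succ b ih => rw [iteratedDeriv_succ]; exact ih.deriv
  obtain ⟨M, hM⟩ := hc.bounded_above_of_compact_support hs
  exact ⟨M, hM⟩

/-- The dilates `n ↦ κ(n / 2^j)` of the window function form a symbol of order `0`, uniformly in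
the scale `j`: each difference gains `2^{-j}`, and `n + 1 ≤ 3 · 2^j` on the support. -/
theorem IsCutoff.isSymbol_window (hφ : IsCutoff q φ)
    (hκ : ContDiffOn ℝ q (window φ) (Set.Ici 0)) :
    IsSymbol q 0 (fun (j n : ℕ) => window φ ((n : ℝ) / 2 ^ j)) := by
  intro b hb
  obtain ⟨M, hM⟩ := hφ.exists_bound_iteratedDeriv hκ hb
  refine ⟨M * 3 ^ b, fun j n => ?_⟩
  have hM0 : 0 ≤ M := (abs_nonneg _).trans (hM 0)
  have hn : (0 : ℝ) < n + 1 := by positivity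
  rcases le_or_gt (2 * 2 ^ j) n with h | h
  · rw [fwdDiff_iter_eq_zero_of_le (N := 2 * 2 ^ j) (fun k hk => ?_) b n h, abs_zero]
    · positivity
    · refine hφ.window_eq_zero_of_ge ((le_div_iff₀ (by positivity)).2 ?_)
      exact_mod_cast hk
  · have heq : (fun n : ℕ => window φ ((n : ℝ) / 2 ^ j)) =
        fun n : ℕ => (Set.Ici 0).indicator (window φ) ((n : ℝ) * (2 ^ j)⁻¹) := by
      funext k
      rw [Set.indicator_of_mem (Set.mem_Ici.2 (by positivity)), div_eq_mul_inv]
    dsimp only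
    rw [heq, fwdDiff_iter_comp_mul]
    refine (abs_fwdDiff_iter_le (by positivity) b
      ((hφ.contDiff_indicator_window hκ).of_le (by exact_mod_cast hb)) hM _).trans ?_
    rw [mul_assoc]
    refine mul_le_mul_of_nonneg_left ?_ hM0
    rw [zero_sub, Real.rpow_neg hn.le, Real.rpow_natCast, ← inv_pow ((n : ℝ) + 1),
      ← mul_pow]
    refine pow_le_pow_left₀ (by positivity) ?_ b
    rw [← div_eq_mul_inv, inv_le_comm₀ (by positivity) (by positivity), inv_div,
      div_le_iff₀ (by norm_num)]
    have h1 : (n : ℝ) < 2 * 2 ^ j := by exact_mod_cast h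
    have h2 : (1 : ℝ) ≤ 2 ^ j := one_le_pow₀ (by norm_num)
    linarith

end Window

/-! ### The number of indices -/

theorem idx_zero (d n : ℕ) (k : Fin (d - 2) → ℤ) : idx d n k 0 = n := rfl

theorem idx_succ {d n : ℕ} {k : Fin (d - 2) → ℤ} {i : ℕ} (h : i < d - 2) :
    idx d n k (i + 1) = k ⟨i, h⟩ := by
  simp [idx, h]

theorem abs_idx_le_of_forall {d n : ℕ} {k : Fin (d - 2) → ℤ}
    (h : ∀ j < d - 2, |idx d n k (j + 1)| ≤ idx d n k j) : ∀ j ≤ d - 2, |idx d n k j| ≤ n := by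
  intro j
  induction j with
  | zero => intro _; simp [idx]
  | succ j ih =>
    intro hj
    exact ((h j (by omega)).trans (le_abs_self _)).trans (ih (by omega))

theorem mem_indexSet_iff {d n : ℕ} {k : Fin (d - 2) → ℤ} :
    k ∈ indexSet d n ↔ ∀ j < d - 2, |idx d n k (j + 1)| ≤ idx d n k j := by
  rw [indexSet, Finset.mem_filter, Fintype.mem_piFinset]
  refine ⟨fun h j hj => h.2 ⟨j, hj⟩, fun h => ⟨fun i => ?_, fun j => h j j.2⟩⟩
  have := abs_idx_le_of_forall h (i + 1) i.2
  rw [idx_succ i.2] at this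
  exact Finset.mem_Icc.2 (abs_le.1 this)

theorem idx_tail {N n l : ℕ} {k : Fin (N + 1) → ℤ} (hk : k 0 = l) (i : ℕ) :
    idx (N + 3) n k (i + 1) = idx (N + 2) l (Fin.tail k) i := by
  rcases i with _ | i
  · rw [idx_succ (d := N + 3) (by omega), idx_zero]
    exact hk
  · by_cases h : i < N
    · rw [idx_succ (d := N + 3) (by omega), idx_succ (d := N + 2) (by omega)]
      rfl
    · simp only [idx]
      rw [dif_neg (by omega), dif_neg (by omega)]

theorem card_indexSet_three (n : ℕ) : (indexSet 3 n).card = 2 * n + 1 := by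
  have h : (indexSet 3 n).card = (Finset.Icc (-(n : ℤ)) n).card := by
    refine Finset.card_nbij' (fun k => k ⟨0, by norm_num⟩) (fun m _ => m) ?_ ?_ ?_ ?_
    · intro k hk
      have := (mem_indexSet_iff.1 hk) 0 (by norm_num)
      rw [idx_succ (by norm_num), idx_zero] at this
      exact Finset.mem_coe.2 (Finset.mem_Icc.2 (abs_le.1 this))
    · intro m hm
      refine Finset.mem_coe.2 (mem_indexSet_iff.2 fun j hj => ?_)
      obtain rfl : j = 0 := by omega
      rw [idx_succ (by norm_num), idx_zero]
      exact abs_le.2 (Finset.mem_Icc.1 hm)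
    · intro k _
      funext i
      have : i = ⟨0, by norm_num⟩ := by
        ext; have := i.2; simp only; omega
      rw [this]
    · intro m _; rfl
  rw [h, Int.card_Icc]
  omega

theorem card_indexSet_succ {N : ℕ} (hN : 1 ≤ N) (n : ℕ) :
    (indexSet (N + 3) n).card = ∑ l ∈ Finset.range (n + 1), (indexSet (N + 2) l).card := by
  rw [← Finset.card_sigma]
  have key : ∀ k : Fin (N + 1) → ℤ, k ∈ indexSet (N + 3) n →
      0 ≤ k 0 ∧ k 0 ≤ n := by
    intro k hk
    have h := mem_indexSet_iff.1 hk
    have h0 := h 0 (by omega)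
    have h1 := h 1 (by omega)
    rw [idx_succ (d := N + 3) (by omega)] at h0
    rw [idx_succ (d := N + 3) (i := 0) (by omega)] at h1
    exact ⟨(abs_nonneg _).trans h1, (le_abs_self _).trans h0⟩
  refine Finset.card_nbij' (α := Fin (N + 1) → ℤ) (β := Σ _ : ℕ, Fin N → ℤ)
    (fun k => ⟨(k 0).toNat, Fin.tail k⟩) (fun p => Fin.cons (p.1 : ℤ) p.2) ?_ ?_ ?_ ?_
  · intro k hk
    obtain ⟨h0, h1⟩ := key k hk
    refine Finset.mem_coe.2 (Finset.mem_sigma.2 ⟨Finset.mem_range.2 (by dsimp only; omega), ?_⟩)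
    refine mem_indexSet_iff.2 fun j hj => ?_
    have hl : k 0 = ((k 0).toNat : ℕ) := by omega
    have := mem_indexSet_iff.1 hk (j + 1) (by omega)
    rw [idx_tail hl, idx_tail hl] at this
    exact this
  · rintro ⟨l, t⟩ hp
    obtain ⟨hl, ht⟩ := Finset.mem_sigma.1 (Finset.mem_coe.1 hp)
    have hl := Finset.mem_range.1 hl
    refine Finset.mem_coe.2 (mem_indexSet_iff.2 fun j hj => ?_)
    have hc : (Fin.cons (l : ℤ) t : Fin (N + 1) → ℤ) 0 = l := rfl
    rcases j with _ | j
    · rw [idx_tail hc, idx_zero, idx_zero]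
      simp only [Nat.abs_cast]
      dsimp only at hl
      omega
    · rw [idx_tail hc, idx_tail hc, Fin.tail_cons]
      exact mem_indexSet_iff.1 ht j (by omega)
  · intro k hk
    obtain ⟨h0, h1⟩ := key k hk
    have hl : (((k 0).toNat : ℕ) : ℤ) = k 0 := by omega
    dsimp only
    rw [hl, Fin.cons_self_tail]
  · rintro ⟨l, t⟩ _
    simp

/-- The number of indices is the dimension of the spherical harmonics of degree `n` in dimension
`d = M + 3`, namely `(2n + d - 2) (n + 1) ⋯ (n + d - 3) / (d - 2)!`. -/
theorem factorial_mul_card_indexSet (M n : ℕ) :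
    (M + 1).factorial * (indexSet (M + 3) n).card =
      (2 * n + M + 1) * ∏ i ∈ Finset.range M, (n + i + 1) := by
  induction M generalizing n with
  | zero =>
    rw [show 0 + 3 = 3 from rfl, card_indexSet_three]
    simp
  | succ M ih =>
    have hrec := card_indexSet_succ (N := M + 1) (by omega)
    induction n with
    | zero =>
      rw [hrec, Finset.sum_range_one, Nat.factorial_succ, mul_assoc, ih 0,
        Finset.prod_range_succ]
      ring
    | succ n ihn =>
      have hs : (indexSet (M + 1 + 3) (n + 1)).card =
          (indexSet (M + 1 + 3) n).card + (indexSet (M + 3) (n + 1)).card := by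
        rw [hrec, hrec, Finset.sum_range_succ _ (n + 1)]
      rw [hs, mul_add, ihn, Nat.factorial_succ, mul_assoc, ih (n + 1),
        Finset.prod_range_succ' _ M, Finset.prod_range_succ _ M]
      have : ∀ i, n + (i + 1) + 1 = n + 1 + i + 1 := fun i => by ring
      simp_rw [this]
      ring

/-! ### Peeling off the variables of a sum of separated products -/

open Polynomial in
theorem exists_gegenbauer_polynomial {a : ℝ} (ha : 0 < a) (m : ℕ) :
    ∃ p : ℝ[X], p.degree = m ∧ ∀ t, p.eval t = gegenbauer a m t := by
  induction m using Nat.twoStepInduction with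
  | zero => exact ⟨1, by simp, fun t => by simp [gegenbauer]⟩
  | one =>
    refine ⟨C (2 * a) * X, ?_, fun t => by simp [gegenbauer]⟩
    rw [degree_C_mul_X (by positivity)]; rfl
  | more m ih1 ih2 =>
    obtain ⟨p, hp, hpe⟩ := ih1
    obtain ⟨r, hr, hre⟩ := ih2
    refine ⟨C (2 * ((m : ℝ) + 1 + a) / (m + 2)) * X * r - C ((m + 2 * a) / (m + 2)) * p,
      ?_, fun t => ?_⟩
    · have h1 : (C (2 * ((m : ℝ) + 1 + a) / (m + 2)) * X * r).degree =
          ((m + 2 : ℕ) : WithBot ℕ) := by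
        rw [degree_mul, degree_C_mul_X (by positivity), hr]
        norm_cast; omega
      have h2 : (C (((m : ℝ) + 2 * a) / (m + 2)) * p).degree = ((m : ℕ) : WithBot ℕ) := by
        rw [degree_C_mul (by positivity), hp]
      rw [degree_sub_eq_left_of_degree_lt, h1]
      rw [h1, h2]
      exact_mod_cast (by omega : m < m + 2)
    · simp only [eval_sub, eval_mul, eval_C, eval_X, hpe, hre, gegenbauer]
      field_simp

open Polynomial in
/-- Linear independence of the Gegenbauer polynomials `C_m^a` on `(-1, 1)`: their degrees differ. -/
theorem gegenbauer_coeff_eq_zero {a : ℝ} (ha : 0 < a) (s : Finset ℕ) (c : ℕ → ℂ)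
    (h : ∀ t ∈ Set.Ioo (-1 : ℝ) 1, ∑ m ∈ s, c m * (gegenbauer a m t : ℂ) = 0) :
    ∀ m ∈ s, c m = 0 := by
  choose p hp hpe using exists_gegenbauer_polynomial ha
  let S : Polynomial.Sequence ℂ :=
    ⟨fun m => (p m).map Complex.ofRealHom, fun m => by rw [degree_map, hp]⟩
  have hli := S.linearIndependent
  rw [linearIndependent_iff'] at hli
  refine hli s c ?_
  have hinf : (Complex.ofReal '' Set.Ioo (-1 : ℝ) 1).Infinite :=
    (Set.Ioo_infinite (by norm_num)).image Complex.ofReal_injective.injOn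
  refine Polynomial.eq_zero_of_infinite_isRoot _ (hinf.mono ?_)
  rintro _ ⟨t, ht, rfl⟩
  rw [Set.mem_ofPred_eq, IsRoot.def, eval_finsetSum, ← h t ht]
  refine Finset.sum_congr rfl fun m _ => ?_
  rw [eval_smul, smul_eq_mul, ← hpe]
  congr 1
  change ((p m).map Complex.ofRealHom).eval (Complex.ofRealHom t) = _
  rw [eval_map_apply]
  rfl

/-- Linear independence of the characters `w ↦ w ^ m` of the unit circle. -/
theorem zpow_coeff_eq_zero (s : Finset ℤ) (c : ℤ → ℂ)
    (h : ∀ w : Circle, ∑ m ∈ s, c m * (w : ℂ) ^ m = 0) : ∀ m ∈ s, c m = 0 := by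
  have hinj : Function.Injective
      (fun m : ℤ => (Circle.coeHom.comp (zpowGroupHom m) : Circle →* ℂ)) := by
    intro m m' hmm
    by_contra hne
    have hsub : ((m - m' : ℤ) : ℝ) ≠ 0 := by exact_mod_cast sub_ne_zero.2 hne
    have h1 : (Circle.exp (Real.pi / (m - m' : ℤ))) ^ m = Circle.exp (Real.pi / (m - m' : ℤ)) ^ m' :=
      Circle.coe_injective (DFunLike.congr_fun hmm (Circle.exp (Real.pi / (m - m' : ℤ))))
    have h2 : (Circle.exp (Real.pi / (m - m' : ℤ))) ^ (m - m') = 1 := by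
      rw [zpow_sub, h1, mul_inv_cancel]
    rw [← Circle.exp_intCast_mul, mul_div_cancel₀ _ hsub] at h2
    have h3 := congrArg (fun w : Circle => (w : ℂ)) h2
    simp only [Circle.coe_exp, Complex.exp_pi_mul_I, Circle.coe_one] at h3
    norm_num at h3
  have hli := (linearIndependent_monoidHom Circle ℂ).comp _ hinj
  rw [linearIndependent_iff'] at hli
  refine hli s c (funext fun w => ?_)
  rw [Finset.sum_apply, Pi.zero_apply, ← h w]
  refine Finset.sum_congr rfl fun m _ => ?_
  change c m * ((w ^ m : Circle) : ℂ) = _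
  rw [Circle.coe_zpow]

/-- Grouping a vanishing sum by the value of `p`. -/
theorem sum_filter_eq_zero {α V X : Type*} [DecidableEq V] (I : Finset α) (b : α → ℂ) (p : α → V)
    (f : V → X → ℂ)
    (hf : ∀ c : V → ℂ, (∀ x, ∑ v ∈ I.image p, c v * f v x = 0) → ∀ v ∈ I.image p, c v = 0)
    (h : ∀ x, ∑ k ∈ I, b k * f (p k) x = 0) {k' : α} (hk' : k' ∈ I) :
    ∑ k ∈ I with p k = p k', b k = 0 := by
  refine hf (fun v => ∑ k ∈ I with p k = v, b k) (fun x => ?_) (p k')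
    (Finset.mem_image_of_mem p hk')
  rw [← h x, ← Finset.sum_fiberwise_of_maps_to (fun k hk => Finset.mem_image_of_mem p hk)]
  refine Finset.sum_congr rfl fun v _ => ?_
  rw [Finset.sum_mul]
  refine Finset.sum_congr rfl fun k hk => ?_
  rw [(Finset.mem_filter.1 hk).2]

/-! ### Linear independence of the spherical harmonics -/

open Classical in
/-- The indices `k` in `I_n^d` which agree with `k'` in the entries `k_i, …, k_{d-2}`. -/
noncomputable def sameTail (d n i : ℕ) (k' : Fin (d - 2) → ℤ) : Finset (Fin (d - 2) → ℤ) :=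
  (indexSet d n).filter fun k => ∀ l, i ≤ l → l ≤ d - 2 → idx d n k l = idx d n k' l

theorem mem_sameTail {d n i : ℕ} {k k' : Fin (d - 2) → ℤ} :
    k ∈ sameTail d n i k' ↔
      k ∈ indexSet d n ∧ ∀ l, i ≤ l → l ≤ d - 2 → idx d n k l = idx d n k' l := by
  rw [sameTail, Finset.mem_filter]

/-- Linear independence of products `∏_j G j (k_j) (k_{j+1}) (t_j) · w^{k_{d-2}}` with separated
variables `t_0, …, t_{d-3}, w`. Knowing that `k_{j+1}, …, k_{d-2}` are fixed, the variable `t_j`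
separates the values of `k_j`; so the indices get fixed one by one, beginning with `k_{d-2}`. -/
theorem coeff_eq_zero_of_separated {d n : ℕ} (G : ℕ → ℤ → ℤ → ℝ → ℂ)
    (hG : ∀ j < d - 2, ∀ (v : ℤ) (s : Finset ℤ), (∀ u ∈ s, |v| ≤ u) → ∀ b : ℤ → ℂ,
      (∀ t : Set.Ioo (-1 : ℝ) 1, ∑ u ∈ s, b u * G j u v t = 0) → ∀ u ∈ s, b u = 0)
    (a : (Fin (d - 2) → ℤ) → ℂ)
    (h : ∀ c : ℕ → ℝ, (∀ j, c j ∈ Set.Ioo (-1 : ℝ) 1) → ∀ w : Circle,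
      ∑ k ∈ indexSet d n,
        a k * (∏ j ∈ Finset.range (d - 2), G j (idx d n k j) (idx d n k (j + 1)) (c j))
          * (w : ℂ) ^ idx d n k (d - 2) = 0) :
    ∀ k ∈ indexSet d n, a k = 0 := by
  have key : ∀ i ≤ d - 2, ∀ k' ∈ indexSet d n, ∀ c : ℕ → ℝ,
      (∀ j, c j ∈ Set.Ioo (-1 : ℝ) 1) →
      ∑ k ∈ sameTail d n i k',
        a k * ∏ j ∈ Finset.range i, G j (idx d n k j) (idx d n k (j + 1)) (c j) = 0 := by
    intro i hi
    induction hi using Nat.decreasingInduction with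
    | of_succ i hiN ih =>
      intro k' hk' c hc
      have hv : ∀ k ∈ sameTail d n (i + 1) k', idx d n k (i + 1) = idx d n k' (i + 1) :=
        fun k hk => (mem_sameTail.1 hk).2 _ le_rfl hiN
      have hsum := sum_filter_eq_zero (X := Set.Ioo (-1 : ℝ) 1) (sameTail d n (i + 1) k')
        (fun k => a k * ∏ j ∈ Finset.range i, G j (idx d n k j) (idx d n k (j + 1)) (c j))
        (fun k => idx d n k i) (fun u t => G i u (idx d n k' (i + 1)) t)
        (fun b hb => hG i hiN _ _ (fun u hu => ?_) b hb) (fun t => ?_)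
        (mem_sameTail.2 ⟨hk', fun _ _ _ => rfl⟩)
      · rw [← hsum]
        refine Finset.sum_congr (Finset.ext fun k => ?_) fun _ _ => rfl
        rw [Finset.mem_filter, mem_sameTail, mem_sameTail, and_assoc]
        refine and_congr_right fun _ => ⟨fun hk => ⟨fun l hl => hk l (by omega),
          hk i le_rfl hiN.le⟩, fun hk l hl hlN => ?_⟩
        rcases hl.eq_or_lt with rfl | hlt
        · exact hk.2
        · exact hk.1 l hlt hlN
      · obtain ⟨k, hk, rfl⟩ := Finset.mem_image.1 hu
        rw [← hv k hk]
        exact mem_indexSet_iff.1 (mem_sameTail.1 hk).1 i hiN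
      · rw [← ih k' hk' (Function.update c i t) (fun j => ?_)]
        · refine Finset.sum_congr rfl fun k hk => ?_
          rw [Finset.prod_range_succ, Function.update_self, hv k hk, ← mul_assoc]
          congr 2
          refine Finset.prod_congr rfl fun j hj => ?_
          rw [Function.update_of_ne (Finset.mem_range.1 hj).ne]
        · rcases eq_or_ne j i with rfl | hne
          · rw [Function.update_self]; exact t.2
          · rw [Function.update_of_ne hne]; exact hc j
    | self =>
      intro k' hk' c hc
      rw [← sum_filter_eq_zero (indexSet d n)
        (fun k => a k * ∏ j ∈ Finset.range (d - 2), G j (idx d n k j) (idx d n k (j + 1)) (c j))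
        (fun k => idx d n k (d - 2)) (fun u (w : Circle) => (w : ℂ) ^ u)
        (fun b hb => zpow_coeff_eq_zero _ b hb) (h c hc) hk']
      refine Finset.sum_congr (Finset.ext fun k => ?_) fun _ _ => rfl
      rw [Finset.mem_filter, mem_sameTail]
      refine and_congr_right fun _ => ⟨fun hk => hk _ le_rfl le_rfl, fun hk l hl hl' => ?_⟩
      obtain rfl : l = d - 2 := le_antisymm hl' hl
      exact hk
  intro k' hk'
  have h0 := key 0 (Nat.zero_le _) k' hk' (fun _ => 0) (fun _ => by norm_num)
  have hF : sameTail d n 0 k' = {k'} := by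
    ext k
    rw [mem_sameTail, Finset.mem_singleton]
    constructor
    · rintro ⟨-, hk⟩
      funext i
      have := hk (i + 1) (Nat.zero_le _) i.2
      rwa [idx_succ i.2, idx_succ i.2] at this
    · rintro rfl
      exact ⟨hk', fun _ _ _ => rfl⟩
  rw [hF] at h0
  simpa using h0

theorem gegenbauer_mul_sqrt_coeff_eq_zero {a : ℝ} (ha : 0 < a) (v : ℤ) (s : Finset ℤ)
    (hs : ∀ u ∈ s, |v| ≤ u) (b : ℤ → ℂ)
    (h : ∀ t : Set.Ioo (-1 : ℝ) 1, ∑ u ∈ s, b u *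
      ((gegenbauer a (u - |v|).toNat t * √(1 - (t : ℝ) ^ 2) ^ v.natAbs : ℝ) : ℂ) = 0) :
    ∀ u ∈ s, b u = 0 := by
  have hinj : Set.InjOn (fun u : ℤ => (u - |v|).toNat) s := by
    intro u hu u' hu' huu
    have := hs u hu
    have := hs u' hu'
    dsimp only at huu
    omega
  have h1 := gegenbauer_coeff_eq_zero ha (s.image fun u : ℤ => (u - |v|).toNat)
    (fun m => b (m + |v|)) (fun t ht => ?_)
  · intro u hu
    have := h1 _ (Finset.mem_image_of_mem _ hu)
    have hu' := hs u hu
    rwa [show (((u - |v|).toNat : ℕ) : ℤ) + |v| = u by omega] at this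
  · rw [Finset.sum_image hinj]
    have hpos : 0 < √(1 - t ^ 2) := Real.sqrt_pos.2 (by nlinarith [ht.1, ht.2])
    have hne : ((√(1 - t ^ 2) ^ v.natAbs : ℝ) : ℂ) ≠ 0 := by
      exact_mod_cast (pow_pos hpos _).ne'
    refine (mul_eq_zero.1 ?_).resolve_right hne
    rw [← h ⟨t, ht⟩, Finset.sum_mul]
    refine Finset.sum_congr rfl fun u hu => ?_
    have hu' := hs u hu
    rw [show (((u - |v|).toNat : ℕ) : ℤ) + |v| = u by omega]
    push_cast
    ring

theorem sum_Icc_coord_sq {d : ℕ} (x : EuclideanSpace ℝ (Fin d)) :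
    ∑ i ∈ Finset.Icc 1 d, coord x i ^ 2 = ‖x‖ ^ 2 := by
  have h : Finset.Icc 1 d = Finset.Ico (0 + 1) (d + 1) := by ext; simp
  rw [h, ← Finset.sum_Ico_add', ← Finset.range_eq_Ico, Finset.sum_range,
    EuclideanSpace.norm_sq_eq]
  refine Finset.sum_congr rfl fun i _ => ?_
  rw [coord, dif_pos ⟨by omega, i.2⟩, Real.norm_eq_abs, sq_abs]
  rfl

/-- Every choice of polar angles is attained at some point of the sphere. -/
theorem exists_point_with_angles {d : ℕ} (hd : 3 ≤ d) (c : ℕ → ℝ)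
    (hc : ∀ m, c m ∈ Set.Ioo (-1 : ℝ) 1) (w : Circle) :
    ∃ x : Sph d, (∀ m ∈ Finset.Icc 2 (d - 1), angle x.1 m = Real.arccos (c m)) ∧
      Complex.exp (Complex.I * (angle x.1 1 : ℂ)) = w := by
  set P : ℕ → ℝ := fun m => ∏ i ∈ Finset.Ico m d, √(1 - c i ^ 2) with hP
  have hs : ∀ m, 0 < 1 - c m ^ 2 := fun m => by nlinarith [(hc m).1, (hc m).2]
  have hPpos : ∀ m, 0 < P m := fun m => Finset.prod_pos fun i _ => Real.sqrt_pos.2 (hs i)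
  set y : EuclideanSpace ℝ (Fin d) := WithLp.toLp 2 fun i =>
    if i.val = 0 then (w : ℂ).im * P 2 else if i.val = 1 then (w : ℂ).re * P 2
    else c i * P (i + 1) with hy
  have hc1 : coord y 1 = (w : ℂ).im * P 2 := by
    rw [coord, dif_pos (by omega)]; simp [hy]
  have hc2 : coord y 2 = (w : ℂ).re * P 2 := by
    rw [coord, dif_pos (by omega)]; simp [hy]
  have hcm : ∀ m, 2 ≤ m → m + 1 ≤ d → coord y (m + 1) = c m * P (m + 1) := by
    intro m hm hmd
    rw [coord, dif_pos (by omega)]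
    simp only [hy, add_tsub_cancel_right]
    rw [if_neg (by omega), if_neg (by omega)]
  have hw : (w : ℂ).re ^ 2 + (w : ℂ).im ^ 2 = 1 := by
    have := Circle.normSq_coe w
    rw [Complex.normSq_apply] at this
    linarith
  have hsum : ∀ m, 1 ≤ m → m + 1 ≤ d → ∑ i ∈ Finset.Icc 1 (m + 1), coord y i ^ 2 = P (m + 1) ^ 2 := by
    intro m hm
    induction m, hm using Nat.le_induction with
    | base =>
      intro _
      rw [Finset.sum_Icc_succ_top (by norm_num), Finset.Icc_self, Finset.sum_singleton, hc1, hc2]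
      linear_combination (P 2) ^ 2 * hw
    | succ m hm ih =>
      intro hmd
      rw [Finset.sum_Icc_succ_top (by omega), ih (by omega), hcm (m + 1) (by omega) hmd]
      have : P (m + 1) = √(1 - c (m + 1) ^ 2) * P (m + 1 + 1) :=
        Finset.prod_eq_prod_Ico_succ_bot (by omega) _
      rw [this, mul_pow, Real.sq_sqrt (hs _).le]
      ring
  have hnorm : ‖y‖ = 1 := by
    have h1 := hsum (d - 1) (by omega) (by omega)
    rw [show d - 1 + 1 = d by omega, sum_Icc_coord_sq] at h1
    have h2 : P d = 1 := by simp [hP]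
    rw [h2, one_pow] at h1
    exact (pow_eq_one_iff_of_nonneg (norm_nonneg _) two_ne_zero).1 h1
  refine ⟨⟨y, by simpa using hnorm⟩, fun m hm => ?_, ?_⟩
  · obtain ⟨hm2, hmd⟩ := Finset.mem_Icc.1 hm
    rw [angle, if_neg (by omega), hsum m (by omega) (by omega), Real.sqrt_sq (hPpos _).le,
      hcm m hm2 (by omega), mul_div_cancel_right₀ _ (hPpos _).ne']
  · rw [angle, if_pos rfl, hc1, hc2]
    have : (((w : ℂ).re * P 2 : ℝ) : ℂ) + Complex.I * (((w : ℂ).im * P 2 : ℝ) : ℂ)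
        = (P 2 : ℂ) * (w : ℂ) := by
      conv_rhs => rw [← Complex.re_add_im (w : ℂ)]
      push_cast; ring
    rw [this, Complex.arg_real_mul _ (hPpos 2), mul_comm]
    have := Complex.norm_mul_exp_arg_mul_I (w : ℂ)
    rwa [Circle.norm_coe, Complex.ofReal_one, one_mul] at this

theorem normConst_pos {d n : ℕ} {k : Fin (d - 2) → ℤ} (hd : 3 ≤ d) (hk : k ∈ indexSet d n) :
    0 < normConst d n k := by
  refine Real.sqrt_pos.2 (mul_pos (div_pos (by positivity)
    (Real.Gamma_pos_of_pos (by positivity))) (Finset.prod_pos fun j hj => ?_))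
  have hj : j < d - 2 := Finset.mem_range.1 hj
  have hjd : (j : ℝ) + 3 ≤ d := by exact_mod_cast (by omega : j + 3 ≤ d)
  have h1 : (0 : ℝ) ≤ (|idx d n k (j + 1)| : ℤ) := by exact_mod_cast abs_nonneg _
  have h2 : (0 : ℝ) ≤ idx d n k j := by
    exact_mod_cast (abs_nonneg _).trans (mem_indexSet_iff.1 hk j hj)
  have h3 : (0 : ℝ) < 2 * (idx d n k j : ℝ) + d - j - 2 := by linarith
  have h4 : 0 < Real.Gamma (((d : ℝ) - j - 2) / 2 + (|idx d n k (j + 1)| : ℤ)) :=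
    Real.Gamma_pos_of_pos (by linarith)
  have h5 : 0 < Real.Gamma ((idx d n k j : ℝ) + (|idx d n k (j + 1)| : ℤ) + d - j - 2) :=
    Real.Gamma_pos_of_pos (by linarith)
  positivity

theorem linearIndependent_sphHarmonic {d : ℕ} (hd : 3 ≤ d) (n : ℕ) :
    LinearIndependent ℂ (fun k : indexSet d n => sphHarmonic d n k) := by
  have hli : LinearIndepOn ℂ (fun k => sphHarmonic d n k)
      (indexSet d n : Set (Fin (d - 2) → ℤ)) := by
    rw [linearIndepOn_finset_iff]
    intro a ha k hk
    refine (mul_eq_zero.1 (coeff_eq_zero_of_separated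
      (fun j u v t => ((gegenbauer (((d : ℝ) - j - 2) / 2 + (|v| : ℤ)) (u - |v|).toNat t
        * √(1 - t ^ 2) ^ v.natAbs : ℝ) : ℂ)) ?_
      (fun k => a k * (normConst d n k : ℂ)) ?_ k hk)).resolve_right
      (by exact_mod_cast (normConst_pos hd hk).ne')
    · intro j hj v s hs b hb
      refine gegenbauer_mul_sqrt_coeff_eq_zero ?_ v s hs b hb
      have hjd : (j : ℝ) + 3 ≤ d := by exact_mod_cast (by omega : j + 3 ≤ d)
      have h1 : (0 : ℝ) ≤ (|v| : ℤ) := by exact_mod_cast abs_nonneg _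
      linarith
    · intro c hc w
      obtain ⟨x, hx, hw⟩ := exists_point_with_angles hd (fun m => c (d - m - 1))
        (fun m => hc _) w
      have := congrFun ha x
      rw [Finset.sum_apply, Pi.zero_apply] at this
      rw [← this]
      refine Finset.sum_congr rfl fun k hk => ?_
      have hexp : Complex.exp (Complex.I * (idx d n k (d - 2) : ℂ) * (angle x.1 1 : ℂ)) =
          (w : ℂ) ^ idx d n k (d - 2) := by
        rw [← hw, ← Complex.exp_int_mul]
        ring_nf
      rw [Pi.smul_apply, smul_eq_mul, sphHarmonic, hexp]
      rw [Complex.ofReal_mul, Complex.ofReal_prod, ← mul_assoc, ← mul_assoc]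
      congr 2
      refine Finset.prod_congr rfl fun j hj => ?_
      have hj := Finset.mem_range.1 hj
      rw [hx (d - j - 1) (Finset.mem_Icc.2 (by omega)), Real.cos_arccos, Real.sin_arccos,
        show d - (d - j - 1) - 1 = j by omega]
      · exact (hc _).1.le
      · exact (hc _).2.le
  exact hli

theorem finrank_harmonicSpace {d : ℕ} (hd : 3 ≤ d) (n : ℕ) :
    Module.finrank ℂ (harmonicSpace d n) = (indexSet d n).card := by
  have h := finrank_span_eq_card (linearIndependent_sphHarmonic hd n)
  rw [Fintype.card_coe] at h
  rw [← h, harmonicSpace, Set.image_eq_range]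
  rfl

/-! ### Curvelets as trigonometric sums -/

theorem sqrt_mul_sin_angle {d : ℕ} (x : EuclideanSpace ℝ (Fin d)) {m : ℕ} (hm : 2 ≤ m) :
    √(∑ i ∈ Finset.Icc 1 (m + 1), coord x i ^ 2) * Real.sin (angle x m) =
      √(∑ i ∈ Finset.Icc 1 m, coord x i ^ 2) := by
  rw [angle, if_neg (by omega), Real.sin_arccos, Finset.sum_Icc_succ_top (by omega)]
  set S := ∑ i ∈ Finset.Icc 1 m, coord x i ^ 2 with hS
  set y := coord x (m + 1)
  have hS0 : 0 ≤ S := Finset.sum_nonneg fun i _ => sq_nonneg _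
  have hy := sq_nonneg y
  rw [← Real.sqrt_mul (by positivity), div_pow, Real.sq_sqrt (by positivity)]
  congr 1
  rcases eq_or_ne (S + y ^ 2) 0 with h | h
  · rw [h, zero_mul]; linarith
  · field_simp; ring

/-- The product of the sines telescopes; this holds on all of the sphere, also at the points whose
angles are given by the junk value `arccos (0 / 0)`. -/
theorem prod_sin_angle {d : ℕ} (x : Sph d) {r : ℕ} (hr : r ≤ d - 2) :
    ∏ j ∈ Finset.range r, Real.sin (angle x.1 (d - j - 1)) =
      √(∑ i ∈ Finset.Icc 1 (d - r), coord x.1 i ^ 2) := by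
  induction r with
  | zero => rw [Finset.prod_range_zero, Nat.sub_zero, sum_Icc_coord_sq]; simp
  | succ r ih =>
    have h := sqrt_mul_sin_angle x.1 (m := d - r - 1) (by omega)
    rw [show d - r - 1 + 1 = d - r by omega] at h
    rw [Finset.prod_range_succ, ih (by omega), h, Nat.sub_sub]

/-- The index `(n, …, n, εn)`; for `ε = ±1` these are the indices with `|k_{d-2}| = n`. -/
def topIndex (d n : ℕ) (ε : ℤ) : Fin (d - 2) → ℤ := fun i => if i.val = d - 3 then ε * n else n

theorem idx_topIndex_of_lt {d n : ℕ} {ε : ℤ} {j : ℕ} (hj : j < d - 2) :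
    idx d n (topIndex d n ε) j = n := by
  rcases j with _ | j
  · rfl
  · rw [idx_succ (by omega), topIndex, if_neg]
    simp only; omega

theorem idx_topIndex_last {d : ℕ} (hd : 3 ≤ d) (n : ℕ) (ε : ℤ) :
    idx d n (topIndex d n ε) (d - 2) = ε * n := by
  obtain ⟨N, rfl⟩ : ∃ N, d = N + 3 := ⟨d - 3, by omega⟩
  rw [show N + 3 - 2 = N + 1 from rfl, idx_succ (d := N + 3) (by omega), topIndex, if_pos]
  rfl

theorem abs_idx_topIndex {d n : ℕ} {ε : ℤ} (hd : 3 ≤ d) (hε : |ε| = 1) {j : ℕ} (hj : j ≤ d - 2) :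
    |idx d n (topIndex d n ε) j| = n := by
  rcases hj.lt_or_eq with h | rfl
  · rw [idx_topIndex_of_lt h, Nat.abs_cast]
  · rw [idx_topIndex_last hd, abs_mul, hε, one_mul, Nat.abs_cast]

theorem topIndex_mem {d n : ℕ} {ε : ℤ} (hd : 3 ≤ d) (hε : |ε| = 1) :
    topIndex d n ε ∈ indexSet d n := by
  refine mem_indexSet_iff.2 fun j hj => ?_
  rw [abs_idx_topIndex hd hε (by omega), idx_topIndex_of_lt hj]

theorem eq_topIndex {d n : ℕ} (hd : 3 ≤ d) {k : Fin (d - 2) → ℤ} (hk : k ∈ indexSet d n)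
    (h : |idx d n k (d - 2)| = n) : k = topIndex d n 1 ∨ k = topIndex d n (-1) := by
  have hmem := mem_indexSet_iff.1 hk
  have hle := abs_idx_le_of_forall hmem
  have hge : ∀ j ≤ d - 2, (n : ℤ) ≤ |idx d n k j| := by
    intro j hj
    induction hj using Nat.decreasingInduction with
    | of_succ j hj ih => exact ih.trans ((hmem j hj).trans (le_abs_self _))
    | self => exact h.ge
  have heq : ∀ j < d - 2, idx d n k j = n := fun j hj => by
    have h1 := hle j hj.le
    have h2 := hge j hj.le
    have h3 := (abs_nonneg _).trans (hmem j hj)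
    rw [abs_of_nonneg h3] at h1 h2
    omega
  have hext : ∀ ε : ℤ, idx d n k (d - 2) = ε * n → k = topIndex d n ε := by
    intro ε hlast
    funext i
    have hi := i.2
    rw [← idx_succ (n := n) (k := k) hi, ← idx_succ (n := n) (k := topIndex d n ε) hi]
    rcases (show i.val + 1 ≤ d - 2 from hi).lt_or_eq with h | h
    · rw [heq _ h, idx_topIndex_of_lt h]
    · rw [h, hlast, idx_topIndex_last hd]
  rcases abs_eq (by positivity) |>.1 h with h | h
  · exact Or.inl (hext 1 (by rw [h, one_mul]))
  · exact Or.inr (hext (-1) (by rw [h, neg_one_mul]))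

/-- For `|k_{d-2}| = n` the duplication formula for the Gamma function simplifies the normalization
constant to `(A_k^n)^2 = Γ(d/2)⁻¹ ∏_j Γ(n + (d-j)/2) / Γ(n + (d-j-1)/2)`. -/
theorem normConst_topIndex {d n : ℕ} {ε : ℤ} (hd : 3 ≤ d) (hε : |ε| = 1) :
    normConst d n (topIndex d n ε) = √((Real.Gamma ((d : ℝ) / 2))⁻¹ *
      ∏ j ∈ Finset.range (d - 2), gammaQuot (n + ((d : ℝ) - j - 2) / 2)) := by
  rw [normConst]
  congr 1
  have hfac : ∀ j ∈ Finset.range (d - 2),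
      (2 : ℝ) ^ (2 * |idx d n (topIndex d n ε) (j + 1)| - (j : ℤ))
          * ((idx d n (topIndex d n ε) j - |idx d n (topIndex d n ε) (j + 1)|).toNat.factorial : ℝ)
          * (2 * (idx d n (topIndex d n ε) j : ℝ) + d - j - 2)
          * Real.Gamma (((d : ℝ) - j - 2) / 2 + (|idx d n (topIndex d n ε) (j + 1)| : ℤ)) ^ 2
          / (Real.sqrt Real.pi * Real.Gamma ((idx d n (topIndex d n ε) j : ℝ)
            + (|idx d n (topIndex d n ε) (j + 1)| : ℤ) + d - j - 2))
      = (2 : ℝ) ^ (4 - (d : ℤ)) * gammaQuot (n + ((d : ℝ) - j - 2) / 2) := by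
    intro j hj
    have hj := Finset.mem_range.1 hj
    have hjd : (j : ℝ) + 3 ≤ d := by exact_mod_cast (by omega : j + 3 ≤ d)
    rw [abs_idx_topIndex hd hε (by omega), idx_topIndex_of_lt hj, sub_self, Int.toNat_zero,
      Nat.factorial_zero]
    set s : ℝ := n + ((d : ℝ) - j - 2) / 2 with hs
    have hn : (0 : ℝ) ≤ n := n.cast_nonneg
    have hs0 : 0 < s := by rw [hs]; linarith
    have hdup := Real.Gamma_mul_Gamma_add_half_of_pos hs0
    have hpow : (2 : ℝ) ^ (1 - 2 * s) = 2 ^ (3 - (d : ℤ) + j - 2 * n) := by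
      rw [← Real.rpow_intCast]
      congr 1
      push_cast
      rw [hs]; ring
    rw [hpow] at hdup
    have e1 : ((d : ℝ) - j - 2) / 2 + ((n : ℤ) : ℝ) = s := by push_cast; rw [hs]; ring
    have e2 : ((n : ℤ) : ℝ) + ((n : ℤ) : ℝ) + d - j - 2 = 2 * s := by push_cast; rw [hs]; ring
    have e3 : 2 * ((n : ℤ) : ℝ) + d - j - 2 = 2 * s := by push_cast; rw [hs]; ring
    have hexp : (2 : ℝ) ^ (2 * (n : ℤ) - j) * 2 * 2 ^ (3 - (d : ℤ) + j - 2 * n)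
        = 2 ^ (4 - (d : ℤ)) := by
      rw [mul_assoc, ← zpow_one_add₀ two_ne_zero, ← zpow_add₀ two_ne_zero]
      congr 1; ring
    have hG := Real.Gamma_pos_of_pos hs0
    have hG1 := Real.Gamma_pos_of_pos (by linarith : 0 < s + 1 / 2)
    have hG2 := Real.Gamma_pos_of_pos (by linarith : 0 < 2 * s)
    have hpi := Real.sqrt_pos.2 Real.pi_pos
    rw [e1, e2, e3, gammaQuot, Real.Gamma_add_one hs0.ne', ← hexp, div_eq_iff (by positivity),
      ← mul_div_assoc, div_mul_eq_mul_div, eq_div_iff (by positivity)]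
    push_cast
    linear_combination (2 : ℝ) ^ (2 * (n : ℤ) - j) * 2 * s * Real.Gamma s * hdup
  rw [Finset.prod_congr rfl hfac, Finset.prod_mul_distrib, Finset.prod_const, Finset.card_range,
    ← mul_assoc]
  congr 1
  rw [← zpow_natCast, ← zpow_mul, div_mul_eq_mul_div, ← zpow_add₀ two_ne_zero, ← one_div]
  congr 1
  rw [Nat.cast_sub (by omega)]
  rw [show ((d : ℤ) - 4) * (d - 2) + (4 - d) * ((d : ℤ) - (2 : ℕ)) = 0 by push_cast; ring, zpow_zero]

theorem norm_mul_exp_int_mul_arg (u : ℂ) {ε : ℤ} (n : ℕ) :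
    ((‖u‖ ^ n : ℝ) : ℂ) * Complex.exp (Complex.I * ((ε * n : ℤ) : ℂ) * (u.arg : ℂ)) =
      ((‖u‖ : ℂ) * Complex.exp (ε * (u.arg * Complex.I))) ^ n := by
  rw [mul_pow, ← Complex.exp_nat_mul]
  push_cast
  ring_nf

/-- With `|k_{d-2}| = n` all Gegenbauer factors have degree `0`, and `Y_k^{d,n}` is a multiple of
`(x_2 ± i x_1)^n`. -/
theorem sphHarmonic_topIndex {d n : ℕ} (hd : 3 ≤ d) {ε : ℤ} (hε : |ε| = 1) (x : Sph d) :
    sphHarmonic d n (topIndex d n ε) x =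
      (normConst d n (topIndex d n ε) : ℂ) *
        ((‖(coord x.1 2 : ℂ) + Complex.I * (coord x.1 1 : ℂ)‖ : ℂ) * Complex.exp
          (ε * (((coord x.1 2 : ℂ) + Complex.I * (coord x.1 1 : ℂ)).arg * Complex.I))) ^ n := by
  set u := (coord x.1 2 : ℂ) + Complex.I * (coord x.1 1 : ℂ) with hu
  have hprod : ∏ j ∈ Finset.range (d - 2),
        (gegenbauer (((d : ℝ) - j - 2) / 2 + (|idx d n (topIndex d n ε) (j + 1)| : ℤ))
            (idx d n (topIndex d n ε) j - |idx d n (topIndex d n ε) (j + 1)|).toNat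
            (Real.cos (angle x.1 (d - j - 1)))
          * Real.sin (angle x.1 (d - j - 1)) ^ (idx d n (topIndex d n ε) (j + 1)).natAbs)
      = ‖u‖ ^ n := by
    have h1 : ‖u‖ = ∏ j ∈ Finset.range (d - 2), Real.sin (angle x.1 (d - j - 1)) := by
      rw [prod_sin_angle x le_rfl, show d - (d - 2) = 1 + 1 by omega,
        Finset.sum_Icc_succ_top (by norm_num), Finset.Icc_self, Finset.sum_singleton, hu,
        mul_comm, Complex.norm_add_mul_I, add_comm]
    rw [h1, ← Finset.prod_pow]
    refine Finset.prod_congr rfl fun j hj => ?_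
    have hj := Finset.mem_range.1 hj
    have h2 : (idx d n (topIndex d n ε) (j + 1)).natAbs = n := by
      have := abs_idx_topIndex (n := n) hd hε (show j + 1 ≤ d - 2 by omega)
      rw [Int.abs_eq_natAbs] at this
      exact_mod_cast this
    rw [abs_idx_topIndex hd hε (by omega), idx_topIndex_of_lt hj, sub_self, Int.toNat_zero, h2,
      gegenbauer, one_mul]
  have hang : angle x.1 1 = u.arg := by rw [angle, if_pos rfl]
  rw [sphHarmonic, hprod, idx_topIndex_last hd, hang, Complex.ofReal_mul, mul_assoc,
    norm_mul_exp_int_mul_arg]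

/-- The coefficient of `(x_2 ± i x_1)^n` in the curvelets, without the window function and the
factor `1/√2`: the square root of `dim H_n^d` times the normalization constant. -/
noncomputable def amplitude (d n : ℕ) : ℝ :=
  √((indexSet d n).card) * √((Real.Gamma ((d : ℝ) / 2))⁻¹ *
      ∏ j ∈ Finset.range (d - 2), gammaQuot (n + ((d : ℝ) - j - 2) / 2))

theorem isSymbol_amplitude {ι : Type*} {d : ℕ} (hd : 3 ≤ d) (q : ℕ) :
    IsSymbol q (3 * ((d : ℝ) - 2) / 4) (fun (_ : ι) n => amplitude d n) := by
  obtain ⟨M, rfl⟩ : ∃ M, d = M + 3 := ⟨d - 3, by omega⟩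
  have hcard : ∀ n : ℕ, ((indexSet (M + 3) n).card : ℝ) = ((M + 1).factorial : ℝ)⁻¹ *
      ((2 * (n : ℝ) + (M + 1)) * ∏ i ∈ Finset.range M, (1 * (n : ℝ) + (i + 1))) := by
    intro n
    have h : (((M + 1).factorial * (indexSet (M + 3) n).card : ℕ) : ℝ) =
      (((2 * n + M + 1) * ∏ i ∈ Finset.range M, (n + i + 1) : ℕ) : ℝ) := by
      rw [factorial_mul_card_indexSet]
    push_cast at h
    rw [eq_inv_mul_iff_mul_eq₀ (by positivity), h]
    simp only [one_mul, add_assoc]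
  have hM : (0 : ℝ) < M + 1 := by positivity
  have hfac : (0 : ℝ) < ((M + 1).factorial : ℝ)⁻¹ := by positivity
  have hG : 0 < (Real.Gamma (((M + 3 : ℕ) : ℝ) / 2))⁻¹ :=
    inv_pos.2 (Real.Gamma_pos_of_pos (by positivity))
  have hβ : ∀ j ∈ Finset.range (M + 3 - 2), 0 < (((M + 3 : ℕ) : ℝ) - j - 2) / 2 := by
    intro j hj
    have : (j : ℝ) < M + 1 := by
      have := Finset.mem_range.1 hj
      exact_mod_cast (by omega : j < M + 1)
    push_cast; linarith
  have hs1 := (((isSymbol_linear (ι := ι) q two_pos hM).mul (IsSymbol.prod (Finset.range M)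
    fun i _ => isSymbol_linear (ι := ι) q one_pos (by positivity : (0 : ℝ) < i + 1))).const_mul
    ((M + 1).factorial : ℝ)⁻¹)
  have he1 := (isElliptic_const (ι := ι) hfac).mul ((isElliptic_linear (ι := ι) two_pos hM).mul
    (IsElliptic.prod (Finset.range M)
    fun i _ => isElliptic_linear (ι := ι) one_pos (by positivity : (0 : ℝ) < i + 1)))
  rw [zero_add] at he1
  have hs2 := (IsSymbol.prod (Finset.range (M + 3 - 2)) fun j hj =>
    isSymbol_gammaQuot (ι := ι) q (hβ j hj)).const_mul (Real.Gamma (((M + 3 : ℕ) : ℝ) / 2))⁻¹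
  have he2 := (isElliptic_const (ι := ι) hG).mul (IsElliptic.prod (Finset.range (M + 3 - 2))
    fun j hj => isElliptic_gammaQuot (ι := ι) (hβ j hj))
  rw [zero_add] at he2
  have h := (hs1.sqrt he1).mul (hs2.sqrt he2)
  rw [Finset.card_range, Finset.card_range, show M + 3 - 2 = M + 1 from rfl] at h
  convert h.congr fun i n => ?_ using 1
  · push_cast; ring
  · rw [amplitude, hcard]
    rfl

open ComplexConjugate in
theorem initialCurvelet_succ {d q : ℕ} (hd : 3 ≤ d) {φ : ℝ → ℝ} (hφ : IsCutoff q φ) (j : ℕ)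
    (x : Sph d) :
    initialCurvelet d (window φ) (j + 1) x =
      ((1 / √2 : ℝ) : ℂ) * (
        ∑ n ∈ Finset.range (2 * 2 ^ j), ((amplitude d n * window φ ((n : ℝ) / 2 ^ j) : ℝ) : ℂ)
          * ((coord x.1 2 : ℂ) + Complex.I * (coord x.1 1 : ℂ)) ^ n
        + conj (∑ n ∈ Finset.range (2 * 2 ^ j),
          ((amplitude d n * window φ ((n : ℝ) / 2 ^ j) : ℝ) : ℂ)
          * ((coord x.1 2 : ℂ) + Complex.I * (coord x.1 1 : ℂ)) ^ n)) := by
  set u := (coord x.1 2 : ℂ) + Complex.I * (coord x.1 1 : ℂ) with hu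
  rw [initialCurvelet, tsum_eq_sum (s := Finset.range (2 * 2 ^ j)) (fun n hn => ?_)]
  · rw [map_sum, ← Finset.sum_add_distrib, Finset.mul_sum]
    refine Finset.sum_congr rfl fun n _ => ?_
    rcases Nat.eq_zero_or_pos n with rfl | hn
    · rw [Nat.cast_zero, zero_div, hφ.window_eq_zero_of_le le_rfl (by norm_num)]
      simp
    have hne : topIndex d n 1 ≠ topIndex d n (-1) := by
      intro h
      have h1 := idx_topIndex_last hd n 1
      rw [h, idx_topIndex_last hd] at h1
      omega
    have hsub : ({topIndex d n 1, topIndex d n (-1)} : Finset (Fin (d - 2) → ℤ)) ⊆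
        indexSet d n := by
      intro k hk
      rcases Finset.mem_insert.1 hk with rfl | hk
      · exact topIndex_mem hd (by norm_num)
      · rw [Finset.mem_singleton.1 hk]
        exact topIndex_mem hd (by norm_num)
    rw [← Finset.sum_subset hsub, Finset.sum_pair hne]
    · have hdir : ∀ ε : ℤ, |ε| = 1 → directionality d n (topIndex d n ε) = 1 / √2 := by
        intro ε hε
        rw [directionality, abs_idx_topIndex hd hε le_rfl, if_pos rfl, mul_one]
      rw [hdir 1 (by norm_num), hdir (-1) (by norm_num), sphHarmonic_topIndex hd (by norm_num),
        sphHarmonic_topIndex hd (by norm_num), normConst_topIndex hd (by norm_num),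
        normConst_topIndex hd (by norm_num), finrank_harmonicSpace hd, amplitude, map_mul, map_pow,
        Complex.conj_ofReal, ← hu]
      have hpos : (‖u‖ : ℂ) * Complex.exp (((1 : ℤ) : ℂ) * (u.arg * Complex.I)) = u := by
        rw [Int.cast_one, one_mul, Complex.norm_mul_exp_arg_mul_I]
      have hneg : (‖u‖ : ℂ) * Complex.exp (((-1 : ℤ) : ℂ) * (u.arg * Complex.I)) = conj u := by
        conv_rhs => rw [← Complex.norm_mul_exp_arg_mul_I u]
        rw [map_mul, Complex.conj_ofReal, ← Complex.exp_conj, map_mul, Complex.conj_ofReal,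
          Complex.conj_I]
        push_cast; ring_nf
      rw [hpos, hneg]
      push_cast
      ring
    · intro k hk hk'
      rw [directionality, if_neg]
      · simp
      · intro h
        rcases eq_topIndex hd hk h with rfl | rfl <;> simp at hk'
  · have hn' : 2 * 2 ^ j ≤ n := by simpa using hn
    have h2 : (2 : ℝ) ≤ (n : ℝ) / 2 ^ j := by
      rw [le_div_iff₀ (by positivity)]; exact_mod_cast hn'
    rw [hφ.window_eq_zero_of_ge h2]
    simp

theorem coord_rotate_inv {d : ℕ} (g : Matrix.specialOrthogonalGroup (Fin d) ℝ) (x : Sph d)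
    (i j : Fin d) (h : (g : Matrix (Fin d) (Fin d) ℝ).mulVec (Pi.single i 1) = Pi.single j 1) :
    coord (rotate g⁻¹ x).1 (i + 1) = x.1 j := by
  rw [coord, dif_pos ⟨by omega, i.2⟩]
  have hinv : ((g⁻¹ : Matrix.specialOrthogonalGroup (Fin d) ℝ) : Matrix (Fin d) (Fin d) ℝ) =
      (g : Matrix (Fin d) (Fin d) ℝ).transpose := by
    rfl
  have hi : (⟨(i : ℕ) + 1 - 1, by omega⟩ : Fin d) = i := Fin.ext (by simp)
  rw [hi]
  simp only [rotate]
  rw [hinv]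
  have hcol : ∀ l, (g : Matrix (Fin d) (Fin d) ℝ) l i = (Pi.single j 1 : Fin d → ℝ) l := by
    intro l
    rw [← h, Matrix.mulVec_single_one]
    rfl
  simp only [Matrix.mulVec, dotProduct, Matrix.transpose_apply, hcol]
  simp [Pi.single_apply]

/-! ### Summation by parts -/

theorem one_sub_mul_sum {a : ℕ → ℝ} {N : ℕ} (ha : ∀ n, N ≤ n → a n = 0) (h0 : a 0 = 0) (z : ℂ) :
    (1 - z) * ∑ n ∈ Finset.range N, (a n : ℂ) * z ^ n =
      z * ∑ n ∈ Finset.range N, ((fwdDiff 1 a n : ℝ) : ℂ) * z ^ n := by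
  have h1 : ∑ n ∈ Finset.range N, (a n : ℂ) * z ^ n =
      ∑ n ∈ Finset.range N, (a (n + 1) : ℂ) * z ^ (n + 1) := by
    have h := Finset.sum_range_succ' (fun n => (a n : ℂ) * z ^ n) N
    rw [Finset.sum_range_succ, ha N le_rfl, h0] at h
    simpa using h
  have h2 : z * ∑ n ∈ Finset.range N, ((fwdDiff 1 a n : ℝ) : ℂ) * z ^ n =
      ∑ n ∈ Finset.range N, (a (n + 1) : ℂ) * z ^ (n + 1) -
        z * ∑ n ∈ Finset.range N, (a n : ℂ) * z ^ n := by
    rw [Finset.mul_sum, Finset.mul_sum, ← Finset.sum_sub_distrib]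
    refine Finset.sum_congr rfl fun n _ => ?_
    simp only [fwdDiff]; push_cast; ring
  rw [h2, ← h1]; ring

theorem one_sub_pow_mul_sum {a : ℕ → ℝ} {N : ℕ} (ha : ∀ n, N ≤ n → a n = 0) (q : ℕ)
    (h0 : ∀ i < q, (fwdDiff 1)^[i] a 0 = 0) (z : ℂ) :
    (1 - z) ^ q * ∑ n ∈ Finset.range N, (a n : ℂ) * z ^ n =
      z ^ q * ∑ n ∈ Finset.range N, (((fwdDiff 1)^[q] a n : ℝ) : ℂ) * z ^ n := by
  induction q with
  | zero => simp
  | succ q ih =>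
    rw [pow_succ', mul_assoc, ih fun i hi => h0 i (by omega), mul_left_comm,
      one_sub_mul_sum (fwdDiff_iter_eq_zero_of_le ha q) (h0 q q.lt_succ_self), ← mul_assoc,
      ← pow_succ]
    simp only [Function.iterate_succ_apply']

theorem abs_arg_le_pi_mul_norm_one_sub (z : ℂ) : |z.arg| ≤ Real.pi * ‖1 - z‖ := by
  rcases eq_or_ne z 0 with rfl | hz
  · simp [Real.pi_nonneg]
  have hpi := Real.pi_pos
  rcases le_or_gt 0 z.re with hre | hre
  · have hsin : |Real.sin z.arg| ≤ ‖1 - z‖ := by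
      have hpos : 0 < ‖z‖ := norm_pos_iff.2 hz
      rw [Complex.sin_arg, abs_div, abs_of_pos hpos, div_le_iff₀ hpos, ← norm_mul,
        ← Real.sqrt_sq_eq_abs, Complex.norm_eq_sqrt_sq_add_sq]
      refine Real.sqrt_le_sqrt ?_
      simp only [Complex.mul_re, Complex.mul_im, Complex.sub_re, Complex.sub_im, Complex.one_re,
        Complex.one_im]
      -- `|(1 - z) z| = |(1 - z) z̄|`, and the imaginary part of `(1 - z) z̄` is `-im z`
      nlinarith [sq_nonneg ((1 - z.re) * z.re - z.im ^ 2)]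
    have h1 : |z.arg| ≤ Real.pi / 2 := Complex.abs_arg_le_pi_div_two_iff.2 hre
    have h2 := Real.mul_abs_le_abs_sin h1
    have h3 : 2 / Real.pi * |z.arg| ≤ ‖1 - z‖ := h2.trans hsin
    rw [div_mul_eq_mul_div, div_le_iff₀ hpi] at h3
    nlinarith [abs_nonneg z.arg]
  · have h1 : 1 ≤ ‖1 - z‖ := by
      refine le_trans ?_ (Complex.abs_re_le_norm (1 - z))
      rw [Complex.sub_re, Complex.one_re, abs_of_pos (by linarith)]
      linarith
    exact (Complex.abs_arg_le_pi z).trans (le_mul_of_one_le_right hpi.le h1)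

theorem rpow_le_of_mem_Icc {α β T x p : ℝ} (hα : 0 < α) (hβ : 0 < β) (hT : 0 < T)
    (h1 : α * T ≤ x) (h2 : x ≤ β * T) : x ^ p ≤ (α ^ p + β ^ p) * T ^ p := by
  have hx : 0 < x := lt_of_lt_of_le (by positivity) h1
  rw [add_mul, ← Real.mul_rpow hα.le hT.le, ← Real.mul_rpow hβ.le hT.le]
  rcases le_total 0 p with hp | hp
  · exact (Real.rpow_le_rpow hx.le h2 hp).trans (le_add_of_nonneg_left (by positivity))
  · exact (Real.rpow_le_rpow_of_nonpos (by positivity) h1 hp).trans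
      (le_add_of_nonneg_right (by positivity))

theorem norm_sum_range_mul_pow_le {N : ℕ} {c : ℕ → ℂ} {z : ℂ} {B y : ℝ} (q : ℕ) (hB : 0 ≤ B)
    (hy : 0 ≤ y) (hz : ‖z‖ ≤ 1)
    (hc : ∀ n < N, c n ≠ 0 → ‖c n‖ ≤ B ∧ y ≤ n + q) :
    ‖z ^ q * ∑ n ∈ Finset.range N, c n * z ^ n‖ ≤ N * (B * ‖z‖ ^ y) := by
  rw [Finset.mul_sum]
  refine (norm_sum_le_of_le (f := fun n => z ^ q * (c n * z ^ n)) _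
    (n := fun _ => B * ‖z‖ ^ y) fun n hn => ?_).trans ?_
  · rcases eq_or_ne (c n) 0 with h0 | h0
    · rw [h0]; simp only [zero_mul, mul_zero, norm_zero]; positivity
    · obtain ⟨h1, h2⟩ := hc n (Finset.mem_range.1 hn) h0
      rw [mul_left_comm, ← pow_add, norm_mul, norm_pow]
      refine mul_le_mul h1 ?_ (by positivity) hB
      rw [← Real.rpow_natCast]
      refine Real.rpow_le_rpow_of_exponent_ge' (norm_nonneg z) hz hy ?_
      push_cast; linarith
  · simp

/-- Power series at frequencies of order `2^j` whose coefficients form a symbol are localized at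
`arg z = 0`. Summation by parts gains the factor `(2^j |1 - z|)^{-q}`. -/
theorem exists_bound_sum_symbol {q : ℕ} (hq : 1 ≤ q) {s : ℝ} (hs : 0 ≤ s) {a : ℕ → ℕ → ℝ}
    (ha : IsSymbol q s a) (hlow : ∀ j n : ℕ, (n : ℝ) ≤ 2 ^ j / 2 → a j n = 0)
    (hhigh : ∀ j n : ℕ, 2 * 2 ^ j ≤ n → a j n = 0) :
    ∃ C : ℝ, 0 < C ∧ ∀ (j : ℕ) (z : ℂ), ‖z‖ ≤ 1 →
      ‖∑ n ∈ Finset.range (2 * 2 ^ j), (a j n : ℂ) * z ^ n‖ * (1 + 2 ^ j * |z.arg|) ^ q ≤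
        C * ((2 : ℝ) ^ j) ^ (s + 1) * ‖z‖ ^ ((2 : ℝ) ^ j / 2) := by
  obtain ⟨A, hA⟩ := ha 0 (Nat.zero_le _)
  obtain ⟨B, hB⟩ := ha q le_rfl
  have hq0 : (0 : ℝ) < q := by exact_mod_cast hq
  -- `A₁`, `B₁` bound the coefficients and their `q`-th differences in units of powers of `2^j`
  set A₁ : ℝ := |A| * 2 ^ s with hA₁
  set B₁ : ℝ := |B| * ((1 / (2 * q)) ^ (s - q) + 2 ^ (s - q)) with hB₁
  have hpi := Real.pi_pos
  refine ⟨2 * A₁ * (1 + 2 * q * Real.pi) ^ q + 2 ^ q * (2 * A₁ + Real.pi ^ q * (2 * B₁)) + 1,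
    by positivity, fun j z hz => ?_⟩
  set T : ℝ := 2 ^ j with hT
  have hT1 : 1 ≤ T := one_le_pow₀ (by norm_num)
  have hT0 : 0 < T := by linarith
  set S : ℂ := ∑ n ∈ Finset.range (2 * 2 ^ j), (a j n : ℂ) * z ^ n with hS
  set r : ℝ := ‖z‖ ^ (T / 2) with hr
  have hr0 : 0 ≤ r := by positivity
  have hlt : ∀ n : ℕ, n < 2 * 2 ^ j → (n : ℝ) + 1 ≤ 2 * T := fun n hn => by
    rw [hT]; exact_mod_cast hn
  have hcast : ((2 * 2 ^ j : ℕ) : ℝ) = 2 * T := by rw [hT]; push_cast; rfl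
  have htriv : ‖S‖ ≤ 2 * A₁ * (T ^ (s + 1) * r) := by
    have h := norm_sum_range_mul_pow_le (N := 2 * 2 ^ j) (c := fun n => (a j n : ℂ)) (z := z)
      (B := A₁ * T ^ s) (y := T / 2) 0 (by positivity) (by positivity) hz fun n hn h0 => ?_
    · rw [pow_zero, one_mul, hcast] at h
      refine h.trans_eq ?_
      rw [Real.rpow_add_one hT0.ne']; ring
    · constructor
      · have h1 := hA j n
        rw [Function.iterate_zero, id_eq, Nat.cast_zero, sub_zero] at h1
        rw [Complex.norm_real, Real.norm_eq_abs, hA₁, mul_assoc,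
          ← Real.mul_rpow (by norm_num) hT0.le]
        exact h1.trans (mul_le_mul (le_abs_self A)
          (Real.rpow_le_rpow (by positivity) (hlt n hn) hs) (by positivity) (abs_nonneg A))
      · by_contra hlt'
        refine h0 ?_
        rw [hlow j n (by push_cast at hlt'; linarith), Complex.ofReal_zero]
  have hparts : q ≤ T / 2 → ‖S‖ * ‖1 - z‖ ^ q * T ^ q ≤ 2 * B₁ * (T ^ (s + 1) * r) := by
    intro hqT
    have hzero := fwdDiff_iter_eq_zero_of_add_le (hlow j)
    have hid := one_sub_pow_mul_sum (hhigh j) q (fun i hi => hzero i 0 (by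
      have : (i : ℝ) < q := by exact_mod_cast hi
      push_cast; linarith)) z
    have h := norm_sum_range_mul_pow_le (N := 2 * 2 ^ j)
      (c := fun n => (((fwdDiff 1)^[q] (a j) n : ℝ) : ℂ)) (z := z)
      (B := B₁ * T ^ (s - q)) (y := T / 2) q (by positivity) (by positivity) hz fun n hn h0 => ?_
    · rw [← hid, norm_mul, norm_pow, ← hS, hcast, mul_comm (‖1 - z‖ ^ q)] at h
      refine (mul_le_mul_of_nonneg_right h (by positivity)).trans_eq ?_
      have : T ^ (s + 1) = T ^ (s - q) * T * T ^ q := by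
        rw [← Real.rpow_natCast, mul_right_comm, ← Real.rpow_add hT0, sub_add_cancel,
          Real.rpow_add_one hT0.ne']
      rw [this]; ring
    · have hlow' : T / 2 < n + q := by
        by_contra hlt'
        refine h0 ?_
        rw [hzero q n (not_lt.1 hlt'), Complex.ofReal_zero]
      refine ⟨?_, hlow'.le⟩
      rw [Complex.norm_real, Real.norm_eq_abs, hB₁, mul_assoc]
      refine (hB j n).trans (mul_le_mul (le_abs_self B)
        (rpow_le_of_mem_Icc (by positivity) (by norm_num) hT0 ?_ (hlt n hn))
        (by positivity) (abs_nonneg B))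
      -- `T / 2 < n + q ≤ q (n + 1)`
      rw [div_mul_eq_mul_div, one_mul, div_le_iff₀ (by positivity)]
      have : (n : ℝ) + q ≤ q * (n + 1) := by
        have h1 : (1 : ℝ) ≤ q := by exact_mod_cast hq
        nlinarith [n.cast_nonneg (α := ℝ)]
      linarith
  have harg := abs_arg_le_pi_mul_norm_one_sub z
  set X : ℝ := T ^ (s + 1) * r with hX
  have hX0 : 0 ≤ X := by positivity
  rw [mul_assoc, ← hX]
  -- for `T / 2 < q` summation by parts would have boundary terms, but then `T |arg z|` is bounded
  rcases le_or_gt (q : ℝ) (T / 2) with hqT | hqT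
  · have h1 : (1 + T * |z.arg|) ^ q ≤ 2 ^ q * (1 + Real.pi ^ q * (‖1 - z‖ ^ q * T ^ q)) := by
      refine (add_pow_le zero_le_one (by positivity) q).trans ?_
      rw [one_pow]
      refine mul_le_mul (pow_le_pow_right₀ (by norm_num) (Nat.sub_le q 1)) ?_ (by positivity)
        (by positivity)
      rw [← mul_pow, ← mul_pow]
      refine add_le_add le_rfl (pow_le_pow_left₀ (by positivity) ?_ q)
      linarith [mul_le_mul_of_nonneg_left harg hT0.le]
    calc ‖S‖ * (1 + T * |z.arg|) ^ q
        ≤ ‖S‖ * (2 ^ q * (1 + Real.pi ^ q * (‖1 - z‖ ^ q * T ^ q))) := by gcongr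
      _ = 2 ^ q * (‖S‖ + Real.pi ^ q * (‖S‖ * ‖1 - z‖ ^ q * T ^ q)) := by ring
      _ ≤ 2 ^ q * (2 * A₁ * X + Real.pi ^ q * (2 * B₁ * X)) := by
          refine mul_le_mul_of_nonneg_left (add_le_add htriv ?_) (by positivity)
          exact mul_le_mul_of_nonneg_left (hparts hqT) (by positivity)
      _ = 2 ^ q * (2 * A₁ + Real.pi ^ q * (2 * B₁)) * X := by ring
      _ ≤ _ := by
          refine mul_le_mul_of_nonneg_right ?_ hX0
          have : 0 ≤ 2 * A₁ * (1 + 2 * q * Real.pi) ^ q := by positivity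
          linarith
  · have h1 : (1 + T * |z.arg|) ^ q ≤ (1 + 2 * q * Real.pi) ^ q := by
      have hTq : T ≤ 2 * q := by linarith
      have := Complex.abs_arg_le_pi z
      gcongr
    calc ‖S‖ * (1 + T * |z.arg|) ^ q
        ≤ 2 * A₁ * X * (1 + 2 * q * Real.pi) ^ q := by gcongr
      _ = 2 * A₁ * (1 + 2 * q * Real.pi) ^ q * X := by ring
      _ ≤ _ := by
          refine mul_le_mul_of_nonneg_right ?_ hX0
          have : 0 ≤ 2 ^ q * (2 * A₁ + Real.pi ^ q * (2 * B₁)) := by positivity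
          linarith

theorem norm_coord_add_le_one {d : ℕ} (hd : 3 ≤ d) (x : Sph d) :
    ‖(coord x.1 2 : ℂ) + Complex.I * (coord x.1 1 : ℂ)‖ ≤ 1 := by
  rw [mul_comm, Complex.norm_add_mul_I, Real.sqrt_le_left zero_le_one]
  have h : ∑ i ∈ Finset.Icc 1 2, coord x.1 i ^ 2 ≤ ∑ i ∈ Finset.Icc 1 d, coord x.1 i ^ 2 :=
    Finset.sum_le_sum_of_subset_of_nonneg (Finset.Icc_subset_Icc le_rfl (by omega))
      fun _ _ _ => sq_nonneg _
  rw [sum_Icc_coord_sq, Finset.sum_Icc_succ_top (by norm_num), Finset.Icc_self,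
    Finset.sum_singleton] at h
  have hx : ‖x.1‖ = 1 := by simp
  rw [hx] at h
  linarith

end Curvelet

theorem theorem4p1 (d : ℕ) (hd : 3 ≤ d) (q : ℕ) (hq : 1 ≤ q) (φ : ℝ → ℝ)
    (hφ : Curvelet.IsCutoff q φ)
    (hκ : ContDiffOn ℝ q (Curvelet.window φ) (Set.Ici 0))
    (hκq : ∃ t₀ ∈ Set.Ioo (1 / 2 : ℝ) 2, ∀ t ∈ Set.Ioo (1 / 2 : ℝ) t₀,
      iteratedDerivWithin q (Curvelet.window φ) (Set.Ici 0) t ≠ 0) :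
    ∃ c : ℝ, 0 < c ∧
      ∀ g₀ : Matrix.specialOrthogonalGroup (Fin d) ℝ,
        (g₀ : Matrix (Fin d) (Fin d) ℝ).mulVec (Pi.single ⟨0, by omega⟩ 1)
            = Pi.single ⟨d - 2, by omega⟩ 1 →
        (g₀ : Matrix (Fin d) (Fin d) ℝ).mulVec (Pi.single ⟨1, by omega⟩ 1)
            = Pi.single ⟨d - 1, by omega⟩ 1 →
        ∀ j : ℕ, 1 ≤ j → ∀ x : Curvelet.Sph d, ∀ z : ℂ,
          z = (x.1 ⟨d - 1, by omega⟩ : ℂ) + Complex.I * (x.1 ⟨d - 2, by omega⟩ : ℂ) →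
          ‖Curvelet.curvelet d (Curvelet.window φ) g₀ j x‖
            ≤ c * (2 : ℝ) ^ ((j : ℝ) * (3 * (d : ℝ) - 2) / 4)
                * ‖z‖ ^ ((2 : ℝ) ^ ((j : ℝ) - 2))
              / (1 + (2 : ℝ) ^ j * |Complex.arg z|) ^ q := by
  have hsym := (Curvelet.isSymbol_amplitude (ι := ℕ) hd q).mul (hφ.isSymbol_window hκ)
  rw [add_zero] at hsym
  have hd' : (3 : ℝ) ≤ d := by exact_mod_cast hd
  have hlow : ∀ j n : ℕ, (n : ℝ) ≤ 2 ^ j / 2 →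
      Curvelet.amplitude d n * Curvelet.window φ ((n : ℝ) / 2 ^ j) = 0 := by
    intro j n hn
    rw [hφ.window_eq_zero_of_le (by positivity), mul_zero]
    rw [div_le_iff₀ (by positivity)]; linarith
  have hhigh : ∀ j n : ℕ, 2 * 2 ^ j ≤ n →
      Curvelet.amplitude d n * Curvelet.window φ ((n : ℝ) / 2 ^ j) = 0 := by
    intro j n hn
    rw [hφ.window_eq_zero_of_ge, mul_zero]
    rw [le_div_iff₀ (by positivity)]; exact_mod_cast hn
  obtain ⟨C, hC, hbound⟩ := Curvelet.exists_bound_sum_symbol hq (by linarith) hsym hlow hhigh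
  refine ⟨2 * C * 2 ^ q, by positivity, fun g₀ h1 h2 j hj x z hz => ?_⟩
  obtain ⟨i, rfl⟩ : ∃ i, j = i + 1 := ⟨j - 1, by omega⟩
  have hc1 := Curvelet.coord_rotate_inv g₀ x _ _ h1
  have hc2 := Curvelet.coord_rotate_inv g₀ x _ _ h2
  have hu : (Curvelet.coord (Curvelet.rotate g₀⁻¹ x).1 2 : ℂ)
      + Complex.I * (Curvelet.coord (Curvelet.rotate g₀⁻¹ x).1 1 : ℂ) = z := by
    rw [hz, ← hc1, ← hc2]
  have hz1 : ‖z‖ ≤ 1 := hu ▸ Curvelet.norm_coord_add_le_one hd _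
  rw [Curvelet.curvelet, Curvelet.initialCurvelet_succ hd hφ, hu, le_div_iff₀ (by positivity)]
  set S := ∑ n ∈ Finset.range (2 * 2 ^ i),
    ((Curvelet.amplitude d n * Curvelet.window φ ((n : ℝ) / 2 ^ i) : ℝ) : ℂ) * z ^ n with hS
  have hnorm : ‖((1 / √2 : ℝ) : ℂ) * (S + (starRingEnd ℂ) S)‖ ≤ 2 * ‖S‖ := by
    rw [norm_mul, Complex.norm_real, Real.norm_of_nonneg (by positivity)]
    have h3 : 1 / √2 ≤ 1 := by
      rw [div_le_one (by positivity), Real.one_le_sqrt]; norm_num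
    have h4 := norm_add_le S ((starRingEnd ℂ) S)
    rw [RCLike.norm_conj] at h4
    calc 1 / √2 * ‖S + (starRingEnd ℂ) S‖ ≤ 1 * (‖S‖ + ‖S‖) := by gcongr
      _ = 2 * ‖S‖ := by ring
  have hden : (1 + (2 : ℝ) ^ (i + 1) * |z.arg|) ^ q ≤ 2 ^ q * (1 + 2 ^ i * |z.arg|) ^ q := by
    rw [← mul_pow]
    gcongr
    rw [pow_succ]; linarith
  have hexp : (2 : ℝ) ^ (((i + 1 : ℕ) : ℝ) - 2) = 2 ^ i / 2 := by
    rw [show ((i + 1 : ℕ) : ℝ) - 2 = i - 1 by push_cast; ring, Real.rpow_sub_one two_ne_zero,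
      Real.rpow_natCast]
  have hpow : ((2 : ℝ) ^ i) ^ (3 * ((d : ℝ) - 2) / 4 + 1) ≤
      2 ^ (((i + 1 : ℕ) : ℝ) * (3 * d - 2) / 4) := by
    rw [← Real.rpow_natCast, ← Real.rpow_mul (by norm_num)]
    refine Real.rpow_le_rpow_of_exponent_le (by norm_num) ?_
    push_cast
    linarith
  rw [hexp]
  calc ‖((1 / √2 : ℝ) : ℂ) * (S + (starRingEnd ℂ) S)‖ * (1 + 2 ^ (i + 1) * |z.arg|) ^ q
      ≤ 2 * ‖S‖ * (2 ^ q * (1 + 2 ^ i * |z.arg|) ^ q) := by gcongr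
    _ = 2 * 2 ^ q * (‖S‖ * (1 + 2 ^ i * |z.arg|) ^ q) := by ring
    _ ≤ 2 * 2 ^ q * (C * (2 ^ i) ^ (3 * ((d : ℝ) - 2) / 4 + 1) * ‖z‖ ^ ((2 : ℝ) ^ i / 2)) := by
        exact mul_le_mul_of_nonneg_left (hbound i z hz1) (by positivity)
    _ ≤ 2 * 2 ^ q * (C * 2 ^ (((i + 1 : ℕ) : ℝ) * (3 * d - 2) / 4) * ‖z‖ ^ ((2 : ℝ) ^ i / 2)) := by
        gcongr
    _ = _ := by ring
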